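/- Let $f_0,f_1$ be probability densities on $\mathbb R$, $0<\rho<1$, $c>0$. For $\pi\in[0,1]$ let $P_\pi$ be the law of $(\Lambda,X_1,X_2,\dots)$ under which $P_\pi(\Lambda=0)=\pi$, $P_\pi(\Lambda=\lambda)=(1-\pi)\rho(1-\rho)^{\lambda-1}$ for $\lambda\ge1$, and, given $\Lambda=\lambda$, the $X_k$ are independent with density $f_0$ for $k<\lambda$ and $f_1$ for $k\ge\lambda$. A sampling strategy is a sequence $\mu=(\mu_k)_{k\ge1}$ of $\{0,1\}$-valued random variables; put $Z_k=X_k$ if $\mu_k=1$, $Z_k=\phi$ (no observation) if $\mu_k=0$, and $\mathcal F_k=\sigma(Z_1,\dots,Z_k)$ ($\mathcal F_0$ trivial). The pair $(\mu,\tau)$ is admissible for $n$ sampling rights if $\mu_k$ is $\mathcal F_{k-1}$-measurable for every $k\ge1$, $\sum_k\mu_k\le n$, and $\tau\in\{0,1,\dots,\infty\}$ is a stopping time of $(\mathcal F_k)_{k\ge 0}$. Let $$J(\pi,n)=\inf_{(\mu,\tau)}\mathbb E_\pi\big[c(\tau-\Lambda)^++\mathbf 1_{\{\tau<\Lambda\}}\big]$$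 over the admissible pairs, and let $\pi_k=P_\pi(\Lambda\le k\mid\mathcal F_k)$ be the posterior process of a strategy; in particular $\pi_0=\pi$. For $q\in[0,1]$ put $q_k=q+\sum_{i=1}^k(1-q)\rho(1-\rho)^{i-1}$ and, for $m\ge1$, $\hat q_m=\dfrac{q_mf_1(X_m)}{q_mf_1(X_m)+(1-q_m)f_0(X_m)}$. Define $$h(q,m)=c\sum_{k=0}^{m-1}q_k+1-q_m\ (m\ge0),\qquad W_V(q,m)=\mathbb E_q\Big[c\sum_{k=0}^{m-1}q_k+V(\hat q_m)\Big]\ (m\ge1),$$ $$V_0(q)=\inf_{m\ge0}h(q,m),\qquad V_n(q)=\mathcal GV_{n-1}(q),\qquad \mathcal GV(q)=\min\Big\{1-q,\ \inf_{m\ge1}W_V(q,m)\Big\}.$$ Theorem. Let $N\ge0$ and $\pi\in[0,1)$. (a) For all $q\in[0,1]$ and $n\ge0$ the expectations $W_{V_n}(q,m)$, $m\ge1$, exist, and the infima $\inf_{m\ge1}W_{V_n}(q,m)$ and $\inf_{m\ge0}h(q,m)$ are attained. (b) $J(\pi,n)=V_n(\pi)<\infty$ for $n=0,\dots,N$. (c)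 Let $\mathcal S_n=\{q\in[0,1]:1-q\le\inf_{m\ge1}W_{V_{N-n-1}}(q,m)\}$ for $0\le n<N$ and $\mathcal S_N=[0,1]$. Consider the following rule, in which $\pi_k$ is the posterior process of the strategy $\mu^*$ itself. Put $t_0^*=0$; take observations exactly at the times $t_1^*<\dots<t_{\eta^*}^*$, where $$t_{n+1}^*-t_n^*\in\operatorname*{argmin}_{m\ge1}W_{V_{N-n-1}}(\pi_{t_n^*},m)\quad(0\le n<\eta^*),\qquad \eta^*=\min\{0\le n\le N:\pi_{t_n^*}\in\mathcal S_n\};$$ stop at $\tau^*=t^*_{\eta^*}+m^*\mathbf 1_{\{\eta^*=N\}}$, where $m^*\in\operatorname{argmin}_{m\ge0}h(\pi_{t_N^*},m)$. There is a pair $(\mu^*,\tau^*)$, admissible for $N$ sampling rights, that follows this rule almost surely under $P_\pi$, and every such pair is optimal: its cost is $J(\pi,N)$. -/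

import Mathlib

open MeasureTheory
open scoped ENNReal

noncomputable section

namespace LimitedSampling

/-- A probability density function on the real line. -/
structure PDF where
  toFun : ℝ → ℝ
  measurable_toFun : Measurable toFun
  nonneg : ∀ x, 0 ≤ toFun x
  lintegral_eq_one : ∫⁻ x, ENNReal.ofReal (toFun x) = 1

/-- The law with density `f`. -/
def PDF.law (f : PDF) : Measure ℝ :=
  volume.withDensity fun x => ENNReal.ofReal (f.toFun x)

instance (f : PDF) : IsProbabilityMeasure f.law :=
  ⟨by rw [PDF.law, withDensity_apply _ MeasurableSet.univ, Measure.restrict_univ,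
    f.lintegral_eq_one]⟩

/-- The parameters of the problem: pre-change density `f₀`, post-change density `f₁`, parameter `ρ`
of the geometric prior, and cost `c` of one slot of detection delay. -/
structure Model where
  f₀ : PDF
  f₁ : PDF
  ρ : ℝ
  c : ℝ
  ρ_pos : 0 < ρ
  ρ_lt_one : ρ < 1
  c_pos : 0 < c

/-- The sample space: a point is `(Λ, (X_k)_k)`. The variables of the problem are `X_1, X_2, …`; the
coordinate `X_0` is a dummy, which no strategy can observe. -/
abbrev Sample : Type := ℕ × (ℕ → ℝ)

/-- The change-point. -/
def Λ (ω : Sample) : ℕ := ω.1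

/-- The variable that can be observed at slot `k ≥ 1`. -/
def X (k : ℕ) (ω : Sample) : ℝ := ω.2 k

/-- The observation at slot `k` under the sampling strategy `μ`: the value `X_k` if `μ_k = 1`,
and the symbol `Sum.inr ()` ("no observation") if `μ_k = 0`. -/
def obs (μ : ℕ → Sample → Bool) (k : ℕ) (ω : Sample) : ℝ ⊕ Unit :=
  if μ k ω = true then Sum.inl (X k ω) else Sum.inr ()

/-- The information `ℱ_k = σ(Z_1, …, Z_k)` available after slot `k`; `ℱ_0` is trivial. -/
abbrev info (μ : ℕ → Sample → Bool) (k : ℕ) : MeasurableSpace Sample :=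
  ⨆ j ∈ Finset.Icc 1 k, MeasurableSpace.comap (obs μ j) inferInstance

/-- The number of sampling rights left at the end of slot `k`, if there are `n` at the start and none
is ever replenished. -/
def rightsLeft (n : ℕ) (μ : ℕ → Sample → Bool) (k : ℕ) (ω : Sample) : ℤ :=
  n - ∑ j ∈ Finset.Icc 1 k, if μ j ω = true then 1 else 0

/-- Admissible pairs for `n` sampling rights. The value `μ 0` is irrelevant. -/
structure Admissible (n : ℕ) (μ : ℕ → Sample → Bool) (τ : Sample → ℕ∞) : Prop where
  /-- `μ_{k+1}` is a measurable function of `Z_1, …, Z_k`. -/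
  causal : ∀ k, Measurable[info μ k] (μ (k + 1))
  /-- The sampling rights are never overdrawn. -/
  rights_nonneg : ∀ k ω, 0 ≤ rightsLeft n μ k ω
  /-- `τ` is a stopping time of the filtration `ℱ`; it may take the value `∞`. -/
  stopping : ∀ k : ℕ, MeasurableSet[info μ k] {ω | τ ω ≤ (k : ℕ∞)}

namespace Model

variable (M : Model)

/-- The prior probability of `Λ = l`. -/
def prior (p : ℝ) : ℕ → ℝ
  | 0 => p
  | l + 1 => (1 - p) * M.ρ * (1 - M.ρ) ^ l

/-- The measure `P_π` (with `π = p`): `Λ` has the prior law, and given `Λ = l` the variables `X_k` are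
independent, with density `f₀` for `k < l` and `f₁` for `k ≥ l`. -/
def P (p : ℝ) : Measure Sample :=
  Measure.sum fun l : ℕ => ENNReal.ofReal (M.prior p l) •
    (Measure.dirac l).prod
      (Measure.infinitePi fun k : ℕ => (if l ≤ k then M.f₁ else M.f₀).law)

/-- The Bayes cost `E_π[c (τ - Λ)⁺ + 1_{τ < Λ}]`, with values in `[0, ∞]`; subtraction in
`ℝ≥0∞` is `(x - y)⁺`. -/
def risk (p : ℝ) (τ : Sample → ℕ∞) : ℝ≥0∞ :=
  ∫⁻ ω, (ENNReal.ofReal M.c * ((τ ω : ℝ≥0∞) - (Λ ω : ℝ≥0∞))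
    + if τ ω < (Λ ω : ℕ∞) then 1 else 0) ∂(M.P p)

/-- The optimal Bayes cost with `n` sampling rights. -/
def J (p : ℝ) (n : ℕ) : ℝ≥0∞ :=
  ⨅ (μ : ℕ → Sample → Bool) (τ : Sample → ℕ∞) (_ : Admissible n μ τ), M.risk p τ

/-- The posterior probability `π_k = P_π(Λ ≤ k | ℱ_k)` under the sampling strategy `μ`. -/
def posterior (p : ℝ) (μ : ℕ → Sample → Bool) (k : ℕ) : Sample → ℝ :=
  condExp (info μ k) (M.P p) (Set.indicator {ω | Λ ω ≤ k} fun _ => 1)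

/-- One slot without observation. -/
def Φ₀ (q : ℝ) : ℝ := q + (1 - q) * M.ρ

/-- One slot with observation `x`. -/
def Φ₁ (x q : ℝ) : ℝ :=
  M.Φ₀ q * M.f₁.toFun x / (M.Φ₀ q * M.f₁.toFun x + (1 - M.Φ₀ q) * M.f₀.toFun x)

/-- The probability that the change has occurred by slot `k`, without any observation. -/
def predict (q : ℝ) (k : ℕ) : ℝ :=
  q + ∑ i ∈ Finset.Icc 1 k, (1 - q) * M.ρ * (1 - M.ρ) ^ (i - 1)

/-- The random cost of waiting `m ≥ 1` slots, sampling in the last of them, and paying `V` at the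
resulting posterior. -/
def waitPayoff (V : ℝ → ℝ) (q : ℝ) (m : ℕ) (ω : Sample) : ℝ :=
  M.c * ∑ k ∈ Finset.range m, M.predict q k + V (M.Φ₁ (X m ω) (M.predict q (m - 1)))

/-- Its expectation under `P_q`. -/
def waitCost (V : ℝ → ℝ) (q : ℝ) (m : ℕ) : ℝ :=
  ∫ ω, M.waitPayoff V q m ω ∂(M.P q)

/-- The cost of stopping after `m ≥ 0` further slots without observation. -/
def blindCost (q : ℝ) (m : ℕ) : ℝ :=
  M.c * ∑ k ∈ Finset.range m, M.predict q k + 1 - M.predict q m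

/-- The operator `𝒢`. -/
def G (V : ℝ → ℝ) (q : ℝ) : ℝ :=
  min (1 - q) (⨅ m : Set.Ici (1 : ℕ), M.waitCost V q m)

/-- The functions `V_n`. -/
def V : ℕ → ℝ → ℝ
  | 0 => fun q => ⨅ m : ℕ, M.blindCost q m
  | n + 1 => M.G (V n)

/-- `argmin` over `m ≥ 1` of the cost of waiting `m` slots and sampling. -/
def waitArgmin (V : ℝ → ℝ) (q : ℝ) : Set ℕ :=
  {m | 1 ≤ m ∧ ∀ m', 1 ≤ m' → M.waitCost V q m ≤ M.waitCost V q m'}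

/-- `argmin` over `m ≥ 0` of the cost of stopping after `m` slots without observation. -/
def blindArgmin (q : ℝ) : Set ℕ :=
  {m | ∀ m', M.blindCost q m ≤ M.blindCost q m'}

/-- The stopping domain `S_n`, for `n ≤ N`. -/
def stopDomain (N n : ℕ) : Set ℝ :=
  {q | q ∈ Set.Icc 0 1 ∧
    (n < N → 1 - q ≤ ⨅ m : Set.Ici (1 : ℕ), M.waitCost (M.V (N - n - 1)) q m)}

/-- The pair `(μ, τ)` follows, almost surely, the rule given by the recursion, with sampling times
`t_1 < ⋯ < t_η` and sample size `η`. Only the values `t_n` with `n ≤ η` matter. -/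
structure FollowsRule (p : ℝ) (N : ℕ) (μ : ℕ → Sample → Bool) (τ : Sample → ℕ∞)
    (t : ℕ → Sample → ℕ) (η : Sample → ℕ) : Prop where
  start : ∀ᵐ ω ∂(M.P p), t 0 ω = 0
  /-- The sampling intervals are minimizers. -/
  interval : ∀ᵐ ω ∂(M.P p), ∀ n < η ω,
    ∃ m ∈ M.waitArgmin (M.V (N - n - 1)) (M.posterior p μ (t n ω) ω), t (n + 1) ω = t n ω + m
  /-- `η = min {0 ≤ n ≤ N : π_{t_n} ∈ S_n}`. -/
  size : ∀ᵐ ω ∂(M.P p),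
    IsLeast {n | n ≤ N ∧ M.posterior p μ (t n ω) ω ∈ M.stopDomain N n} (η ω)
  /-- Observations are taken exactly at `t_1, …, t_η`. -/
  sampling : ∀ᵐ ω ∂(M.P p), ∀ k, 1 ≤ k →
    (μ k ω = true ↔ ∃ n, 1 ≤ n ∧ n ≤ η ω ∧ t n ω = k)
  /-- `τ = t_η + m^* 1_{η = N}`. -/
  stop_early : ∀ᵐ ω ∂(M.P p), η ω < N → τ ω = (t (η ω) ω : ℕ∞)
  stop_last : ∀ᵐ ω ∂(M.P p), η ω = N →
    ∃ m ∈ M.blindArgmin (M.posterior p μ (t N ω) ω), τ ω = ((t N ω + m : ℕ) : ℕ∞)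

end Model

end LimitedSampling

end

/-! The pair (sampling rights left, posterior) is a controlled Markov chain. The recursion for `V`
jumps from sample to sample, while strategies act slot by slot, so the proof breaks the recursion
into one-slot inequalities. From posterior `q`, stopping costs `1 - q`; a blind slot costs `c q` and
moves `q` to `Φ₀ q`; a sampled slot costs `c q` and moves `q` to the random `Φ₁ y q`. The value is
at most the expected cost of each choice: `V_le_wait`, `V_le_sample`, `IsValue.le`. The only
delicate case is a blind slot followed by a stop: sampling in that slot is no worse, because the
posterior is a martingale and `V q ≤ 1 - q`.

The chain structure comes from `filter`: for any causal strategy, the recursion `post` integrates to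
the probability of `Λ ≤ k` over every event of `info μ k`. It rests on the memoryless prior and on
the independence of the next observation from the past given whether the change has occurred. Hence
`risk_eq_tsum` writes the risk as a sum over slots of expectations involving `post` only.

Lower bound (`le_risk`): telescoping the one-slot inequalities bounds `V n p` by the cost up to time
`k` plus a remainder of at most the probability of `k ≤ τ`. If the risk is finite then `τ` is almost
surely finite and the remainder vanishes.

Optimality (`FollowsRule.risk_eq`): on a path that follows the rule, every one-slot inequality is an
equality. A wait that is optimal as a whole remains optimal after its first slot (`V_eq_wait`,
`V_eq_blind`). Telescoping now gives equalities, and dropping the remainder leaves risk at most `V N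
p`.

Existence (`admissible_rule`, `followsRule_rule`): waiting costs tend to infinity, so least
minimizers exist, and they depend measurably on the posterior. Each decision of the resulting rule
is made at an earlier sampling time, which gives causality. -/

noncomputable section

/-! ### The law `P`: the next observation and the next change given the past. -/

namespace LimitedSampling

/-- The information carried by `X_0, …, X_k`. -/
abbrev past (k : ℕ) : MeasurableSpace Sample :=
  MeasurableSpace.comap (fun ω : Sample => (Finset.range (k + 1)).restrict ω.2) inferInstance

theorem measurable_X (k : ℕ) : Measurable (X k) :=
  (measurable_pi_apply k).comp measurable_snd

theorem measurable_Λ : Measurable Λ := measurable_fst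

theorem past_le (k : ℕ) : past k ≤ (inferInstance : MeasurableSpace Sample) := by
  rintro _ ⟨B, hB, rfl⟩
  exact ((Finset.measurable_restrict _).comp measurable_snd) hB

theorem measurable_X_past {j k : ℕ} (h : j ≤ k) : Measurable[past k] (X j) := by
  have : X j = (fun x : Finset.range (k + 1) → ℝ => x ⟨j, by simp; omega⟩) ∘
      (fun ω : Sample => (Finset.range (k + 1)).restrict ω.2) := rfl
  rw [this]
  exact (measurable_pi_apply _).comp (comap_measurable _)

theorem past_mono {j k : ℕ} (h : j ≤ k) : past j ≤ past k := by
  have : (fun ω : Sample => (Finset.range (j + 1)).restrict ω.2) =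
      (Finset.restrict₂ (π := fun _ => ℝ) (Finset.range_mono (by omega : j + 1 ≤ k + 1))) ∘
      (fun ω : Sample => (Finset.range (k + 1)).restrict ω.2) := rfl
  rw [past, this, ← MeasurableSpace.comap_comp]
  exact MeasurableSpace.comap_mono (Finset.measurable_restrict₂ _).comap_le

namespace Model

variable (M : Model)

/-- The law of the sequence `X` given `Λ = l`. -/
def seqLaw (l : ℕ) : Measure (ℕ → ℝ) :=
  Measure.infinitePi fun k : ℕ => (if l ≤ k then M.f₁ else M.f₀).law

instance (l : ℕ) : IsProbabilityMeasure (M.seqLaw l) := by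
  unfold seqLaw; infer_instance

theorem P_apply (p : ℝ) {S : Set Sample} (hS : MeasurableSet S) :
    M.P p S = ∑' l, ENNReal.ofReal (M.prior p l) * M.seqLaw l (Prod.mk l ⁻¹' S) := by
  rw [P, Measure.sum_apply _ hS]
  congr 1; ext l
  rw [Measure.smul_apply, Measure.prod_apply hS,
    lintegral_dirac' _ (measurable_measure_prodMk_left hS)]
  rfl

theorem one_sub_rho_mem : 0 ≤ 1 - M.ρ ∧ 1 - M.ρ < 1 := by
  have := M.ρ_pos; have := M.ρ_lt_one; constructor <;> linarith

theorem prior_nonneg {p : ℝ} (hp : p ∈ Set.Icc (0 : ℝ) 1) (l : ℕ) : 0 ≤ M.prior p l := by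
  have h1 := M.one_sub_rho_mem
  have h2 := M.ρ_pos
  cases l with
  | zero => exact hp.1
  | succ l =>
    have : 0 ≤ 1 - p := by linarith [hp.2]
    have := h1.1
    unfold prior; positivity

theorem hasSum_prior_tail (p : ℝ) (k : ℕ) :
    HasSum (fun l : ℕ => M.prior p (k + 1 + l)) ((1 - p) * (1 - M.ρ) ^ k) := by
  have h := (hasSum_geometric_of_lt_one M.one_sub_rho_mem.1 M.one_sub_rho_mem.2).mul_left
    ((1 - p) * M.ρ * (1 - M.ρ) ^ k)
  have hρ := M.ρ_pos.ne'
  have e : (fun l : ℕ => M.prior p (k + 1 + l)) =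
      fun l => (1 - p) * M.ρ * (1 - M.ρ) ^ k * (1 - M.ρ) ^ l := by
    ext l
    rw [show k + 1 + l = (k + l) + 1 by ring, prior, pow_add]; ring
  rw [e, show (1 - p) * (1 - M.ρ) ^ k =
    (1 - p) * M.ρ * (1 - M.ρ) ^ k * (1 - (1 - M.ρ))⁻¹ by rw [sub_sub_cancel]; field_simp]
  exact h

theorem tsum_prior_tail {p : ℝ} (hp : p ∈ Set.Icc (0 : ℝ) 1) (k : ℕ) :
    ∑' l : ℕ, ENNReal.ofReal (M.prior p (k + 1 + l)) =
      ENNReal.ofReal ((1 - p) * (1 - M.ρ) ^ k) := by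
  rw [← (M.hasSum_prior_tail p k).tsum_eq,
    ENNReal.ofReal_tsum_of_nonneg (fun l => M.prior_nonneg hp _) (M.hasSum_prior_tail p k).summable]

theorem isProbabilityMeasure_P {p : ℝ} (hp : p ∈ Set.Icc (0 : ℝ) 1) :
    IsProbabilityMeasure (M.P p) := by
  constructor
  rw [M.P_apply p MeasurableSet.univ]
  simp only [Set.preimage_univ, measure_univ, mul_one]
  rw [tsum_eq_zero_add' ENNReal.summable]
  have := M.tsum_prior_tail hp 0
  simp only [pow_zero, mul_one, zero_add, add_comm 1] at this
  rw [this, prior, ← ENNReal.ofReal_add hp.1 (by linarith [hp.2])]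
  simp

/-- While the change lies in the future, the coordinates up to `k` are independent with density
`f₀`, whatever its date. -/
theorem seqLaw_eq_of_lt {k l l' : ℕ} (hl : k < l) (hl' : k < l')
    {B : Set (Finset.range (k + 1) → ℝ)} (hB : MeasurableSet B) :
    M.seqLaw l ((Finset.range (k + 1)).restrict ⁻¹' B) =
      M.seqLaw l' ((Finset.range (k + 1)).restrict ⁻¹' B) := by
  have key : ∀ l, k < l → (M.seqLaw l).map (Finset.range (k + 1)).restrict =
      Measure.pi (fun _ : Finset.range (k + 1) => M.f₀.law) := by
    intro l hl
    rw [seqLaw, Measure.infinitePi_map_restrict]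
    congr 1
    ext1 i
    have := Finset.mem_range.1 i.2
    rw [if_neg (by omega)]
  rw [← Measure.map_apply (Finset.measurable_restrict _) hB,
    ← Measure.map_apply (Finset.measurable_restrict _) hB, key l hl, key l' hl']

theorem seqLaw_inter (l k : ℕ) {B : Set (Finset.range (k + 1) → ℝ)} (hB : MeasurableSet B)
    {C : Set ℝ} (hC : MeasurableSet C) :
    M.seqLaw l ((Finset.range (k + 1)).restrict ⁻¹' B ∩ (fun x => x (k + 1)) ⁻¹' C) =
      M.seqLaw l ((Finset.range (k + 1)).restrict ⁻¹' B) *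
        (if l ≤ k + 1 then M.f₁ else M.f₀).law C := by
  have hind : ProbabilityTheory.iIndepFun (fun (i : ℕ) (x : ℕ → ℝ) => x i) (M.seqLaw l) :=
    ProbabilityTheory.iIndepFun_infinitePi (X := fun _ x => x) (fun i => measurable_id)
  have h := hind.indepFun_finset (Finset.range (k + 1)) {k + 1} (by simp)
    (fun i => measurable_pi_apply i)
  have h' := h.comp measurable_id
    (measurable_pi_apply (⟨k + 1, by simp⟩ : ({k + 1} : Finset ℕ)))
  have := h'.measure_inter_preimage_eq_mul B C hB hC
  refine this.trans ?_
  congr 1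
  rw [← Measure.infinitePi_map_eval (fun k : ℕ => (if l ≤ k then M.f₁ else M.f₀).law) (k + 1)]
  exact (Measure.map_apply (measurable_pi_apply (k + 1)) hC).symm

/-- For each `l ≤ k + 1` the coordinate `k + 1` is independent of the earlier ones with law `f₁`;
this factor does not depend on `l` and leaves the sum. -/
theorem P_inter_le (p : ℝ) {k : ℕ} {A : Set Sample} (hA : MeasurableSet[past k] A)
    {C : Set ℝ} (hC : MeasurableSet C) :
    M.P p (A ∩ X (k + 1) ⁻¹' C ∩ {ω | Λ ω ≤ k + 1}) =
      M.P p (A ∩ {ω | Λ ω ≤ k + 1}) * M.f₁.law C := by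
  have hA' := past_le k _ hA
  have hΛ : MeasurableSet {ω | Λ ω ≤ k + 1} := measurable_Λ measurableSet_Iic
  rw [M.P_apply p ((hA'.inter (measurable_X _ hC)).inter hΛ), M.P_apply p (hA'.inter hΛ),
    ← ENNReal.tsum_mul_right]
  obtain ⟨B, hB, rfl⟩ := hA
  congr 1; ext l
  by_cases hl : l ≤ k + 1
  · have e1 : (Prod.mk l ⁻¹' ((fun ω : Sample => (Finset.range (k + 1)).restrict ω.2) ⁻¹' B ∩
        X (k + 1) ⁻¹' C ∩ {ω | Λ ω ≤ k + 1})) =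
        (Finset.range (k + 1)).restrict ⁻¹' B ∩ (fun x => x (k + 1)) ⁻¹' C := by
      ext x; simp [Λ, X, hl]
    have e2 : (Prod.mk l ⁻¹' ((fun ω : Sample => (Finset.range (k + 1)).restrict ω.2) ⁻¹' B ∩
        {ω | Λ ω ≤ k + 1})) = (Finset.range (k + 1)).restrict ⁻¹' B := by
      ext x; simp [Λ, hl]
    rw [e1, e2, M.seqLaw_inter l k hB hC, if_pos hl, mul_assoc]
  · have e1 : ∀ S : Set Sample, Prod.mk l ⁻¹' (S ∩ {ω | Λ ω ≤ k + 1}) = ∅ := by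
      intro S; ext x; simp [Λ]; omega
    simp [e1]

theorem P_inter_gt (p : ℝ) {k : ℕ} {A : Set Sample} (hA : MeasurableSet[past k] A)
    {C : Set ℝ} (hC : MeasurableSet C) :
    M.P p (A ∩ X (k + 1) ⁻¹' C ∩ {ω | Λ ω ≤ k + 1}ᶜ) =
      M.P p (A ∩ {ω | Λ ω ≤ k + 1}ᶜ) * M.f₀.law C := by
  have hA' := past_le k _ hA
  have hΛ : MeasurableSet {ω | Λ ω ≤ k + 1}ᶜ := (measurable_Λ measurableSet_Iic).compl
  rw [M.P_apply p ((hA'.inter (measurable_X _ hC)).inter hΛ), M.P_apply p (hA'.inter hΛ),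
    ← ENNReal.tsum_mul_right]
  obtain ⟨B, hB, rfl⟩ := hA
  congr 1; ext l
  by_cases hl : l ≤ k + 1
  · have e1 : ∀ S : Set Sample, Prod.mk l ⁻¹' (S ∩ {ω | Λ ω ≤ k + 1}ᶜ) = ∅ := by
      intro S; ext x; simp [Λ, hl]
    simp [e1]
  · have e1 : (Prod.mk l ⁻¹' ((fun ω : Sample => (Finset.range (k + 1)).restrict ω.2) ⁻¹' B ∩
        X (k + 1) ⁻¹' C ∩ {ω | Λ ω ≤ k + 1}ᶜ)) =
        (Finset.range (k + 1)).restrict ⁻¹' B ∩ (fun x => x (k + 1)) ⁻¹' C := by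
      ext x; simp [Λ, X]; omega
    have e2 : (Prod.mk l ⁻¹' ((fun ω : Sample => (Finset.range (k + 1)).restrict ω.2) ⁻¹' B ∩
        {ω | Λ ω ≤ k + 1}ᶜ)) = (Finset.range (k + 1)).restrict ⁻¹' B := by
      ext x; simp [Λ]; omega
    rw [e1, e2, M.seqLaw_inter l k hB hC, if_neg hl, mul_assoc]

/-- The geometric prior is memoryless, and the past has the same law for all `l > k`, so the hazard
rate remains `ρ` after conditioning on the past. -/
theorem P_inter_eq {p : ℝ} (hp : p ∈ Set.Icc (0 : ℝ) 1) {k : ℕ} {A : Set Sample}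
    (hA : MeasurableSet[past k] A) :
    M.P p (A ∩ {ω | Λ ω = k + 1}) =
      ENNReal.ofReal M.ρ * M.P p (A ∩ {ω | Λ ω ≤ k}ᶜ) := by
  have hA' := past_le k _ hA
  have hΛ : MeasurableSet {ω | Λ ω ≤ k}ᶜ := (measurable_Λ measurableSet_Iic).compl
  have hΛ' : MeasurableSet {ω | Λ ω = k + 1} := measurable_Λ (measurableSet_singleton _)
  rw [M.P_apply p (hA'.inter hΛ'), M.P_apply p (hA'.inter hΛ)]
  obtain ⟨B, hB, rfl⟩ := hA
  set a := M.seqLaw (k + 1) ((Finset.range (k + 1)).restrict ⁻¹' B) with ha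
  rw [tsum_eq_single (k + 1), ← ENNReal.summable.sum_add_tsum_nat_add' (k := k + 1),
    Finset.sum_eq_zero, zero_add]
  · have e1 : (Prod.mk (k + 1) ⁻¹' ((fun ω : Sample => (Finset.range (k + 1)).restrict ω.2) ⁻¹' B ∩
        {ω | Λ ω = k + 1})) = (Finset.range (k + 1)).restrict ⁻¹' B := by
      ext x; simp [Λ]
    have e2 : ∀ l, M.seqLaw (l + (k + 1)) (Prod.mk (l + (k + 1)) ⁻¹'
        ((fun ω : Sample => (Finset.range (k + 1)).restrict ω.2) ⁻¹' B ∩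
        {ω | Λ ω ≤ k}ᶜ)) = a := by
      intro l
      rw [ha, M.seqLaw_eq_of_lt (l := k + 1) (l' := l + (k + 1)) (by omega) (by omega) hB]
      congr 1
      ext x; simp [Λ]; omega
    simp only [e2, e1]
    rw [ENNReal.tsum_mul_right, ← mul_assoc]
    congr 1
    simp only [add_comm _ (k + 1)]
    rw [M.tsum_prior_tail hp, ← ENNReal.ofReal_mul M.ρ_pos.le, prior]
    congr 1; ring
  · intro l hl
    have : (Prod.mk l ⁻¹' ((fun ω : Sample => (Finset.range (k + 1)).restrict ω.2) ⁻¹' B ∩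
        {ω | Λ ω ≤ k}ᶜ)) = ∅ := by
      ext x; have := Finset.mem_range.1 hl; simp [Λ]; omega
    simp [this]
  · intro l hl
    have : (Prod.mk l ⁻¹' ((fun ω : Sample => (Finset.range (k + 1)).restrict ω.2) ⁻¹' B ∩
        {ω | Λ ω = k + 1})) = ∅ := by
      ext x; simp [Λ, hl]
    simp [this]

theorem predict_zero (q : ℝ) : M.predict q 0 = q := by simp [predict]

theorem predict_eq (q : ℝ) (k : ℕ) : M.predict q k = 1 - (1 - q) * (1 - M.ρ) ^ k := by
  induction k with
  | zero => simp [predict]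
  | succ k ih =>
    rw [predict] at ih ⊢
    rw [Finset.sum_Icc_succ_top (by omega), ← add_assoc, ih, add_tsub_cancel_right, pow_succ]
    ring

theorem predict_succ (q : ℝ) (k : ℕ) : M.predict q (k + 1) = M.Φ₀ (M.predict q k) := by
  rw [predict_eq, predict_eq, Φ₀]; ring

theorem predict_Φ₀ (q : ℝ) (k : ℕ) : M.predict (M.Φ₀ q) k = M.predict q (k + 1) := by
  rw [predict_eq, predict_eq, Φ₀]; ring

theorem P_gt_eq {p : ℝ} (hp : p ∈ Set.Icc (0 : ℝ) 1) (k : ℕ) :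
    M.P p {ω | Λ ω ≤ k}ᶜ = ENNReal.ofReal (1 - M.predict p k) := by
  have hΛ : MeasurableSet {ω | Λ ω ≤ k}ᶜ := (measurable_Λ measurableSet_Iic).compl
  rw [M.P_apply p hΛ, ← ENNReal.summable.sum_add_tsum_nat_add' (k := k + 1),
    Finset.sum_eq_zero, zero_add, predict_eq, sub_sub_cancel, ← M.tsum_prior_tail hp]
  · congr 1; ext l
    have : Prod.mk (l + (k + 1)) ⁻¹' {ω : Sample | Λ ω ≤ k}ᶜ = Set.univ := by
      ext x; simp [Λ]; omega
    rw [this, measure_univ, mul_one, add_comm l]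
  · intro l hl
    have : Prod.mk l ⁻¹' {ω : Sample | Λ ω ≤ k}ᶜ = ∅ := by
      ext x; have := Finset.mem_range.1 hl; simp [Λ]; omega
    simp [this]

/-- On `A ∩ D` the joint law of `T` and `X (k + 1)` is a product, as one sees on rectangles; Tonelli
does the rest. -/
theorem lintegral_next_of_inter {E : Type*} [MeasurableSpace E] {p : ℝ}
    (hp : p ∈ Set.Icc (0 : ℝ) 1) {k : ℕ} {D : Set Sample} {f : PDF}
    (hD : ∀ A, MeasurableSet[past k] A → ∀ C, MeasurableSet C →
      M.P p (A ∩ X (k + 1) ⁻¹' C ∩ D) = M.P p (A ∩ D) * f.law C)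
    {A : Set Sample} (hA : MeasurableSet[past k] A) {T : Sample → E}
    (hT : Measurable[past k] T) {G : E → ℝ → ℝ≥0∞} (hG : Measurable (Function.uncurry G)) :
    ∫⁻ ω in A ∩ D, G (T ω) (X (k + 1) ω) ∂(M.P p) =
      ∫⁻ ω in A ∩ D, ∫⁻ y, G (T ω) y ∂f.law ∂(M.P p) := by
  have := M.isProbabilityMeasure_P hp
  have hT' : Measurable T := hT.mono (past_le k) le_rfl
  set ν := (M.P p).restrict (A ∩ D)
  have hmap : ν.map (fun ω => (T ω, X (k + 1) ω)) = (ν.map T).prod f.law := by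
    refine (Measure.prod_eq fun B C hB hC => ?_).symm
    rw [Measure.map_apply (hT'.prodMk (measurable_X _)) (hB.prod hC), Measure.map_apply hT' hB,
      Measure.restrict_apply ((hT'.prodMk (measurable_X _)) (hB.prod hC)),
      Measure.restrict_apply (hT' hB)]
    convert hD _ (MeasurableSet.inter (hT hB) hA) C hC using 2
    · ext ω; simp only [Set.mem_inter_iff, Set.mem_preimage, Set.mem_prod]; tauto
    · rw [Set.inter_assoc]
  calc _ = ∫⁻ z, Function.uncurry G z ∂ν.map (fun ω => (T ω, X (k + 1) ω)) :=
        (lintegral_map hG (hT'.prodMk (measurable_X _))).symm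
    _ = _ := by
        rw [hmap, lintegral_prod _ hG.aemeasurable, lintegral_map hG.lintegral_prod_right' hT']
        rfl

/-- After the change, the next observation has density `f₁` and is independent of the past. -/
theorem lintegral_next_le {E : Type*} [MeasurableSpace E] {p : ℝ} (hp : p ∈ Set.Icc (0 : ℝ) 1)
    {k : ℕ} {A : Set Sample} (hA : MeasurableSet[past k] A) {T : Sample → E}
    (hT : Measurable[past k] T) {G : E → ℝ → ℝ≥0∞} (hG : Measurable (Function.uncurry G)) :
    ∫⁻ ω in A ∩ {ω | Λ ω ≤ k + 1}, G (T ω) (X (k + 1) ω) ∂(M.P p) =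
      ∫⁻ ω in A ∩ {ω | Λ ω ≤ k + 1}, ∫⁻ y, G (T ω) y ∂M.f₁.law ∂(M.P p) :=
  M.lintegral_next_of_inter hp (fun _ hA _ hC => M.P_inter_le p hA hC) hA hT hG

/-- Before the change, the next observation has density `f₀` and is independent of the past. -/
theorem lintegral_next_gt {E : Type*} [MeasurableSpace E] {p : ℝ} (hp : p ∈ Set.Icc (0 : ℝ) 1)
    {k : ℕ} {A : Set Sample} (hA : MeasurableSet[past k] A) {T : Sample → E}
    (hT : Measurable[past k] T) {G : E → ℝ → ℝ≥0∞} (hG : Measurable (Function.uncurry G)) :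
    ∫⁻ ω in A ∩ {ω | Λ ω ≤ k + 1}ᶜ, G (T ω) (X (k + 1) ω) ∂(M.P p) =
      ∫⁻ ω in A ∩ {ω | Λ ω ≤ k + 1}ᶜ, ∫⁻ y, G (T ω) y ∂M.f₀.law ∂(M.P p) :=
  M.lintegral_next_of_inter hp (fun _ hA _ hC => M.P_inter_gt p hA hC) hA hT hG

end Model

end LimitedSampling

end

/-! ### Bayes updates, the functions `V n`, and their one-slot inequalities. -/

noncomputable section

namespace LimitedSampling

/-- The projection of the line to `[0, 1]`. -/
def clamp (q : ℝ) : ℝ := max 0 (min 1 q)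

theorem clamp_mem (q : ℝ) : clamp q ∈ Set.Icc (0 : ℝ) 1 := by
  constructor <;> simp [clamp]

theorem clamp_of_mem {q : ℝ} (hq : q ∈ Set.Icc (0 : ℝ) 1) : clamp q = q := by
  simp [clamp, hq.1, hq.2]

@[fun_prop]
theorem measurable_clamp : Measurable clamp := by
  unfold clamp; fun_prop

namespace Model

variable (M : Model)

theorem Φ₀_mem {q : ℝ} (hq : q ∈ Set.Icc (0 : ℝ) 1) : M.Φ₀ q ∈ Set.Icc (0 : ℝ) 1 := by
  have := M.ρ_pos; have := M.ρ_lt_one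
  obtain ⟨h0, h1⟩ := hq
  constructor <;> unfold Φ₀ <;> nlinarith

theorem predict_mem {q : ℝ} (hq : q ∈ Set.Icc (0 : ℝ) 1) (k : ℕ) :
    M.predict q k ∈ Set.Icc (0 : ℝ) 1 := by
  induction k with
  | zero => rwa [predict_zero]
  | succ k ih => rw [predict_succ]; exact M.Φ₀_mem ih

/-- The predictive density of the next observation. -/
def density (q y : ℝ) : ℝ := M.Φ₀ q * M.f₁.toFun y + (1 - M.Φ₀ q) * M.f₀.toFun y

theorem Φ₁_mem {q : ℝ} (hq : q ∈ Set.Icc (0 : ℝ) 1) (y : ℝ) : M.Φ₁ y q ∈ Set.Icc (0 : ℝ) 1 := by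
  obtain ⟨h0, h1⟩ := M.Φ₀_mem hq
  have h2 := M.f₁.nonneg y
  have h3 := M.f₀.nonneg y
  have h4 : 0 ≤ 1 - M.Φ₀ q := by linarith
  unfold Φ₁
  constructor
  · positivity
  · apply div_le_one_of_le₀
    · have := mul_nonneg h4 h3; linarith
    · positivity

theorem density_nonneg {q : ℝ} (hq : q ∈ Set.Icc (0 : ℝ) 1) (y : ℝ) : 0 ≤ M.density q y := by
  obtain ⟨h0, h1⟩ := M.Φ₀_mem hq
  have h2 := M.f₁.nonneg y
  have h3 := M.f₀.nonneg y
  have h4 : 0 ≤ 1 - M.Φ₀ q := by linarith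
  unfold density; positivity

theorem density_mul_Φ₁ {q : ℝ} (hq : q ∈ Set.Icc (0 : ℝ) 1) (y : ℝ) :
    M.density q y * M.Φ₁ y q = M.Φ₀ q * M.f₁.toFun y := by
  -- Where the density vanishes, so do both of its nonnegative summands, and the value of the
  -- quotient by zero is harmless.
  by_cases h : M.density q y = 0
  · obtain ⟨h0, h1⟩ := M.Φ₀_mem hq
    have h2 := mul_nonneg h0 (M.f₁.nonneg y)
    have h3 := mul_nonneg (sub_nonneg.2 h1) (M.f₀.nonneg y)
    rw [h, zero_mul]
    unfold density at h
    linarith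
  · exact mul_div_cancel₀ _ h

/-- The predictive law of the next observation. -/
def mix (q : ℝ) : Measure ℝ :=
  ENNReal.ofReal (M.Φ₀ q) • M.f₁.law + ENNReal.ofReal (1 - M.Φ₀ q) • M.f₀.law

theorem isProbabilityMeasure_mix {q : ℝ} (hq : q ∈ Set.Icc (0 : ℝ) 1) :
    IsProbabilityMeasure (M.mix q) := by
  constructor
  obtain ⟨h0, h1⟩ := M.Φ₀_mem hq
  simp only [mix, Measure.coe_add, Measure.coe_smul, Pi.add_apply, Pi.smul_apply, measure_univ,
    smul_eq_mul, mul_one]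
  rw [← ENNReal.ofReal_add h0 (by linarith)]
  simp

theorem lintegral_mix (q : ℝ) (g : ℝ → ℝ≥0∞) :
    ∫⁻ y, g y ∂M.mix q = ENNReal.ofReal (M.Φ₀ q) * ∫⁻ y, g y ∂M.f₁.law +
      ENNReal.ofReal (1 - M.Φ₀ q) * ∫⁻ y, g y ∂M.f₀.law := by
  rw [mix, lintegral_add_measure, lintegral_smul_measure, lintegral_smul_measure, smul_eq_mul,
    smul_eq_mul]

theorem lintegral_law (f : PDF) {g : ℝ → ℝ≥0∞} (hg : Measurable g) :
    ∫⁻ y, g y ∂f.law = ∫⁻ y, ENNReal.ofReal (f.toFun y) * g y := by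
  rw [PDF.law, lintegral_withDensity_eq_lintegral_mul _ f.measurable_toFun.ennreal_ofReal hg]
  rfl

theorem lintegral_mix_eq {q : ℝ} (hq : q ∈ Set.Icc (0 : ℝ) 1) {g : ℝ → ℝ≥0∞}
    (hg : Measurable g) :
    ∫⁻ y, g y ∂M.mix q = ∫⁻ y, ENNReal.ofReal (M.density q y) * g y := by
  obtain ⟨h0, h1⟩ := M.Φ₀_mem hq
  have m1 := M.f₁.measurable_toFun
  have m0 := M.f₀.measurable_toFun
  rw [lintegral_mix, lintegral_law _ hg, lintegral_law _ hg,
    ← lintegral_const_mul _ (by fun_prop), ← lintegral_const_mul _ (by fun_prop),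
    ← lintegral_add_left (by fun_prop)]
  congr 1; ext y
  have h2 := M.f₁.nonneg y
  have h3 := M.f₀.nonneg y
  have h4 : 0 ≤ 1 - M.Φ₀ q := by linarith
  rw [density, ENNReal.ofReal_add (by positivity) (by positivity), ENNReal.ofReal_mul h0,
    ENNReal.ofReal_mul h4]
  ring

theorem measurable_Φ₀ : Measurable M.Φ₀ := by unfold Φ₀; fun_prop

theorem measurable_Φ₁ : Measurable (fun z : ℝ × ℝ => M.Φ₁ z.1 z.2) := by
  have m1 := M.f₁.measurable_toFun
  have m0 := M.f₀.measurable_toFun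
  have m2 := M.measurable_Φ₀
  unfold Φ₁; fun_prop

theorem lintegral_mix_Φ₁ {q : ℝ} (hq : q ∈ Set.Icc (0 : ℝ) 1) {g : ℝ → ℝ≥0∞}
    (hg : Measurable g) :
    ∫⁻ y, ENNReal.ofReal (M.Φ₁ y q) * g y ∂M.mix q =
      ENNReal.ofReal (M.Φ₀ q) * ∫⁻ y, g y ∂M.f₁.law := by
  have m2 : Measurable fun y => M.Φ₁ y q :=
    M.measurable_Φ₁.comp (by fun_prop : Measurable fun y => (y, q))
  have m1 := M.f₁.measurable_toFun
  rw [M.lintegral_mix_eq hq (by fun_prop), lintegral_law _ hg,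
    ← lintegral_const_mul _ (by fun_prop)]
  congr 1; ext y
  rw [← mul_assoc, ← mul_assoc, ← ENNReal.ofReal_mul (M.density_nonneg hq y),
    M.density_mul_Φ₁ hq, ENNReal.ofReal_mul (M.Φ₀_mem hq).1]

theorem lintegral_mix_one_sub_Φ₁ {q : ℝ} (hq : q ∈ Set.Icc (0 : ℝ) 1) {g : ℝ → ℝ≥0∞}
    (hg : Measurable g) :
    ∫⁻ y, ENNReal.ofReal (1 - M.Φ₁ y q) * g y ∂M.mix q =
      ENNReal.ofReal (1 - M.Φ₀ q) * ∫⁻ y, g y ∂M.f₀.law := by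
  have m2 : Measurable fun y => M.Φ₁ y q :=
    M.measurable_Φ₁.comp (by fun_prop : Measurable fun y => (y, q))
  have m1 := M.f₀.measurable_toFun
  rw [M.lintegral_mix_eq hq (by fun_prop), lintegral_law _ hg,
    ← lintegral_const_mul _ (by fun_prop)]
  congr 1; ext y
  rw [← mul_assoc, ← mul_assoc, ← ENNReal.ofReal_mul (M.density_nonneg hq y), mul_sub, mul_one,
    M.density_mul_Φ₁ hq, density, add_sub_cancel_left,
    ENNReal.ofReal_mul (sub_nonneg.2 (M.Φ₀_mem hq).2)]

/-- `mix` itself applies `Φ₀` once, so its argument is the prediction for slot `k`, one slot before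
the observation. -/
theorem map_X_succ {q : ℝ} (hq : q ∈ Set.Icc (0 : ℝ) 1) (k : ℕ) :
    (M.P q).map (X (k + 1)) = M.mix (M.predict q k) := by
  have := M.isProbabilityMeasure_P hq
  have hΛ : MeasurableSet {ω | Λ ω ≤ k + 1} := measurable_Λ measurableSet_Iic
  ext C hC
  rw [Measure.map_apply (measurable_X _) hC, ← measure_inter_add_sdiff _ hΛ, Set.sdiff_eq]
  have h1 := M.P_inter_le q (k := k) (MeasurableSet.univ) hC
  have h2 := M.P_inter_gt q (k := k) (MeasurableSet.univ) hC
  rw [Set.univ_inter, Set.univ_inter] at h1 h2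
  have h3 : M.P q {ω | Λ ω ≤ k + 1} = ENNReal.ofReal (M.predict q (k + 1)) := by
    have := prob_compl_eq_one_sub (μ := M.P q) hΛ.compl
    rw [compl_compl, M.P_gt_eq hq] at this
    rw [this, ← ENNReal.ofReal_one,
      ← ENNReal.ofReal_sub _ (by linarith [(M.predict_mem hq (k + 1)).2]), sub_sub_cancel]
  rw [h1, h2, h3, M.P_gt_eq hq, predict_succ]
  rfl

/-- The properties of the functions `V_n` that the recursion preserves. -/
structure IsValue (V : ℝ → ℝ) : Prop where
  -- Formulas such as `waitCost_succ` are proved only on `[0, 1]`; composing with `clamp` turns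
  -- measurability there into a statement on the whole line.
  measurable : Measurable (fun q => V (clamp q))
  nonneg : ∀ q ∈ Set.Icc (0 : ℝ) 1, 0 ≤ V q
  le : ∀ q ∈ Set.Icc (0 : ℝ) 1, V q ≤ 1 - q

/-- The expectation of `V` at the posterior after one slot with observation. -/
def sampleMean (V : ℝ → ℝ) (q : ℝ) : ℝ := ∫ y, V (M.Φ₁ y q) ∂M.mix q

variable {M} {V : ℝ → ℝ}

theorem IsValue.measurable_comp_Φ₁ (hV : IsValue V) {q : ℝ} (hq : q ∈ Set.Icc (0 : ℝ) 1) :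
    Measurable fun y => V (M.Φ₁ y q) := by
  have m2 : Measurable fun y => M.Φ₁ y q :=
    M.measurable_Φ₁.comp (by fun_prop : Measurable fun y => (y, q))
  have : (fun y => V (M.Φ₁ y q)) = fun y => V (clamp (M.Φ₁ y q)) := by
    ext y; rw [clamp_of_mem (M.Φ₁_mem hq y)]
  rw [this]
  exact hV.measurable.comp m2

theorem IsValue.mem (hV : IsValue V) {q : ℝ} (hq : q ∈ Set.Icc (0 : ℝ) 1) :
    V q ∈ Set.Icc (0 : ℝ) 1 :=
  ⟨hV.nonneg q hq, (hV.le q hq).trans (by linarith [hq.1])⟩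

theorem IsValue.integrable (hV : IsValue V) {q : ℝ} (hq : q ∈ Set.Icc (0 : ℝ) 1) :
    Integrable (fun y => V (M.Φ₁ y q)) (M.mix q) := by
  have := M.isProbabilityMeasure_mix hq
  exact Integrable.of_mem_Icc 0 1 (hV.measurable_comp_Φ₁ hq).aemeasurable
    (ae_of_all _ fun y => hV.mem (M.Φ₁_mem hq y))

theorem IsValue.ofReal_sampleMean (hV : IsValue V) {q : ℝ} (hq : q ∈ Set.Icc (0 : ℝ) 1) :
    ENNReal.ofReal (M.sampleMean V q) = ∫⁻ y, ENNReal.ofReal (V (M.Φ₁ y q)) ∂M.mix q :=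
  ofReal_integral_eq_lintegral_ofReal (hV.integrable hq)
    (ae_of_all _ fun y => (hV.mem (M.Φ₁_mem hq y)).1)

theorem IsValue.sampleMean_nonneg (hV : IsValue V) {q : ℝ} (hq : q ∈ Set.Icc (0 : ℝ) 1) :
    0 ≤ M.sampleMean V q :=
  integral_nonneg fun y => (hV.mem (M.Φ₁_mem hq y)).1

/-- Since `V q ≤ 1 - q`, this follows from the martingale property: the mean of `1 - Φ₁ y q` is `1 -
Φ₀ q`. -/
theorem IsValue.sampleMean_le (hV : IsValue V) {q : ℝ} (hq : q ∈ Set.Icc (0 : ℝ) 1) :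
    M.sampleMean V q ≤ 1 - M.Φ₀ q := by
  rw [← ENNReal.ofReal_le_ofReal_iff (sub_nonneg.2 (M.Φ₀_mem hq).2), hV.ofReal_sampleMean hq]
  have := M.lintegral_mix_one_sub_Φ₁ hq (g := fun _ => 1) measurable_const
  simp only [mul_one, lintegral_const, measure_univ] at this
  rw [← this]
  exact lintegral_mono fun y => ENNReal.ofReal_le_ofReal (hV.le _ (M.Φ₁_mem hq y))

theorem IsValue.measurable_sampleMean (hV : IsValue V) :
    Measurable fun q => M.sampleMean V (clamp q) := by
  -- The measure `mix q` varies with `q`; splitting it gives integrals against two fixed laws, to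
  -- which measurability of parametric integrals applies.
  have : (fun q => M.sampleMean V (clamp q)) = fun q =>
      (ENNReal.ofReal (M.Φ₀ (clamp q)) *
          ∫⁻ y, ENNReal.ofReal (V (clamp (M.Φ₁ y (clamp q)))) ∂M.f₁.law +
        ENNReal.ofReal (1 - M.Φ₀ (clamp q)) *
          ∫⁻ y, ENNReal.ofReal (V (clamp (M.Φ₁ y (clamp q)))) ∂M.f₀.law).toReal := by
    ext q
    rw [← lintegral_mix]
    simp_rw [clamp_of_mem (M.Φ₁_mem (clamp_mem q) _)]
    rw [← hV.ofReal_sampleMean (clamp_mem q),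
      ENNReal.toReal_ofReal (hV.sampleMean_nonneg (clamp_mem q))]
  rw [this]
  have m0 := M.measurable_Φ₀
  have m1 : Measurable fun z : ℝ × ℝ => ENNReal.ofReal (V (clamp (M.Φ₁ z.2 (clamp z.1)))) :=
    (hV.measurable.comp (M.measurable_Φ₁.comp
      (by fun_prop : Measurable fun z : ℝ × ℝ => (z.2, clamp z.1)))).ennreal_ofReal
  have m2 : ∀ f : PDF, Measurable fun q =>
    ∫⁻ y, ENNReal.ofReal (V (clamp (M.Φ₁ y (clamp q)))) ∂f.law := fun f => m1.lintegral_prod_right'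
  have m3 := m2 M.f₁
  have m4 := m2 M.f₀
  fun_prop

theorem IsValue.integrable_waitPayoff (hV : IsValue V) {q : ℝ} (hq : q ∈ Set.Icc (0 : ℝ) 1)
    (k : ℕ) : Integrable (M.waitPayoff V q (k + 1)) (M.P q) := by
  have := M.isProbabilityMeasure_P hq
  have hk := M.predict_mem hq k
  refine (integrable_const _).add ?_
  exact Integrable.of_mem_Icc 0 1
    ((hV.measurable_comp_Φ₁ hk).comp (measurable_X (k + 1))).aemeasurable
    (ae_of_all _ fun y => hV.mem (M.Φ₁_mem hk _))

theorem IsValue.waitCost_succ (hV : IsValue V) {q : ℝ} (hq : q ∈ Set.Icc (0 : ℝ) 1) (k : ℕ) :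
    M.waitCost V q (k + 1) =
      M.c * ∑ j ∈ Finset.range (k + 1), M.predict q j + M.sampleMean V (M.predict q k) := by
  have := M.isProbabilityMeasure_P hq
  have hk := M.predict_mem hq k
  have hi : Integrable (fun ω => V (M.Φ₁ (X (k + 1) ω) (M.predict q k))) (M.P q) :=
    Integrable.of_mem_Icc 0 1
      ((hV.measurable_comp_Φ₁ hk).comp (measurable_X (k + 1))).aemeasurable
      (ae_of_all _ fun y => hV.mem (M.Φ₁_mem hk _))
  unfold waitCost waitPayoff
  rw [add_tsub_cancel_right, integral_add (integrable_const _) hi, integral_const, sampleMean,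
    ← M.map_X_succ hq, integral_map (measurable_X _).aemeasurable
      (hV.measurable_comp_Φ₁ hk).aestronglyMeasurable]
  simp

theorem IsValue.waitCost_one (hV : IsValue V) {q : ℝ} (hq : q ∈ Set.Icc (0 : ℝ) 1) :
    M.waitCost V q 1 = M.c * q + M.sampleMean V q := by
  rw [hV.waitCost_succ hq 0]; simp [predict_zero]

theorem sum_predict_succ (q : ℝ) (m : ℕ) :
    ∑ j ∈ Finset.range (m + 1), M.predict q j =
      q + ∑ j ∈ Finset.range m, M.predict (M.Φ₀ q) j := by
  rw [Finset.sum_range_succ', predict_zero, add_comm]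
  simp_rw [predict_Φ₀]

theorem IsValue.waitCost_succ_succ (hV : IsValue V) {q : ℝ} (hq : q ∈ Set.Icc (0 : ℝ) 1) (k : ℕ) :
    M.waitCost V q (k + 2) = M.c * q + M.waitCost V (M.Φ₀ q) (k + 1) := by
  rw [hV.waitCost_succ hq (k + 1), hV.waitCost_succ (M.Φ₀_mem hq), sum_predict_succ, predict_Φ₀]
  ring

theorem blindCost_zero (q : ℝ) : M.blindCost q 0 = 1 - q := by
  simp [blindCost, predict_zero]

theorem blindCost_succ (q : ℝ) (m : ℕ) :
    M.blindCost q (m + 1) = M.c * q + M.blindCost (M.Φ₀ q) m := by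
  rw [blindCost, blindCost, sum_predict_succ, predict_Φ₀]; ring

theorem sum_predict_nonneg {q : ℝ} (hq : q ∈ Set.Icc (0 : ℝ) 1) (m : ℕ) :
    0 ≤ M.c * ∑ j ∈ Finset.range m, M.predict q j :=
  mul_nonneg M.c_pos.le (Finset.sum_nonneg fun j _ => (M.predict_mem hq j).1)

theorem blindCost_nonneg {q : ℝ} (hq : q ∈ Set.Icc (0 : ℝ) 1) (m : ℕ) : 0 ≤ M.blindCost q m := by
  have := sum_predict_nonneg (M := M) hq m
  have := (M.predict_mem hq m).2
  unfold blindCost; linarith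

theorem IsValue.waitCost_nonneg (hV : IsValue V) {q : ℝ} (hq : q ∈ Set.Icc (0 : ℝ) 1) (k : ℕ) :
    0 ≤ M.waitCost V q (k + 1) := by
  rw [hV.waitCost_succ hq]
  exact add_nonneg (sum_predict_nonneg hq _) (hV.sampleMean_nonneg (M.predict_mem hq k))

/-- After the first slot each prediction is at least `ρ`, so the delay cost grows linearly. Hence
the infima in the recursion are attained. -/
theorem tendsto_sum_predict {q : ℝ} (hq : q ∈ Set.Icc (0 : ℝ) 1) :
    Filter.Tendsto (fun m : ℕ => M.c * ∑ j ∈ Finset.range m, M.predict q j) Filter.atTop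
      Filter.atTop := by
  have hc := M.c_pos
  have hρ := M.ρ_pos
  refine Filter.Tendsto.const_mul_atTop hc ?_
  -- The subtracted `ρ` allows for the initial term `q`, which may be `0`.
  have h : ∀ m : ℕ, (m : ℝ) * M.ρ - M.ρ ≤ ∑ j ∈ Finset.range m, M.predict q j := by
    intro m
    induction m with
    | zero => simp [hρ.le]
    | succ m ih =>
      rcases m with _ | m
      · simpa [predict_zero] using hq.1
      rw [Finset.sum_range_succ]
      have : M.ρ ≤ M.predict q (m + 1) := by
        have h1 := (M.predict_mem hq m).1
        have h2 := M.ρ_lt_one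
        rw [predict_succ, Φ₀]; nlinarith
      push_cast at ih ⊢; linarith
  refine Filter.tendsto_atTop_mono h ?_
  exact Filter.tendsto_atTop_add_const_right _ _
    (tendsto_natCast_atTop_atTop.atTop_mul_const hρ)

theorem blindArgmin_nonempty {q : ℝ} (hq : q ∈ Set.Icc (0 : ℝ) 1) : (M.blindArgmin q).Nonempty := by
  have : Filter.Tendsto (M.blindCost q) Filter.cofinite Filter.atTop := by
    rw [Nat.cofinite_eq_atTop]
    refine Filter.tendsto_atTop_mono (fun m => ?_) (tendsto_sum_predict (M := M) hq)
    have := (M.predict_mem hq m).2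
    unfold blindCost; linarith
  obtain ⟨m, hm⟩ := this.exists_forall_le
  exact ⟨m, hm⟩

theorem IsValue.waitArgmin_nonempty (hV : IsValue V) {q : ℝ} (hq : q ∈ Set.Icc (0 : ℝ) 1) :
    (M.waitArgmin V q).Nonempty := by
  have : Filter.Tendsto (fun k => M.waitCost V q (k + 1)) Filter.cofinite Filter.atTop := by
    rw [Nat.cofinite_eq_atTop]
    refine Filter.tendsto_atTop_mono (fun m => ?_)
      ((tendsto_sum_predict (M := M) hq).comp (Filter.tendsto_add_atTop_nat 1))
    have := hV.sampleMean_nonneg (M := M) (M.predict_mem hq m)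
    rw [hV.waitCost_succ hq]; simpa using this
  obtain ⟨m, hm⟩ := this.exists_forall_le
  refine ⟨m + 1, by omega, fun m' hm' => ?_⟩
  obtain ⟨k, rfl⟩ := Nat.exists_eq_add_of_le' hm'
  exact hm k

theorem IsValue.bddBelow_waitCost (hV : IsValue V) {q : ℝ} (hq : q ∈ Set.Icc (0 : ℝ) 1) :
    BddBelow (Set.range fun m : Set.Ici (1 : ℕ) => M.waitCost V q m) := by
  refine ⟨0, ?_⟩
  rintro _ ⟨⟨m, hm⟩, rfl⟩
  obtain ⟨k, rfl⟩ := Nat.exists_eq_add_of_le' (Set.mem_Ici.1 hm)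
  exact hV.waitCost_nonneg hq k

theorem IsValue.iInf_waitCost_eq (hV : IsValue V) {q : ℝ} (hq : q ∈ Set.Icc (0 : ℝ) 1) {m : ℕ}
    (hm : m ∈ M.waitArgmin V q) :
    ⨅ m : Set.Ici (1 : ℕ), M.waitCost V q m = M.waitCost V q m := by
  apply le_antisymm
  · exact ciInf_le (hV.bddBelow_waitCost hq) (⟨m, hm.1⟩ : Set.Ici (1 : ℕ))
  · have : Nonempty (Set.Ici (1 : ℕ)) := ⟨⟨1, by simp⟩⟩
    exact le_ciInf fun m' => hm.2 m' m'.2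

theorem IsValue.measurable_waitCost (hV : IsValue V) {m : ℕ} (hm : 1 ≤ m) :
    Measurable fun q => M.waitCost V (clamp q) m := by
  obtain ⟨k, rfl⟩ := Nat.exists_eq_add_of_le' hm
  have e : (fun q => M.waitCost V (clamp q) (k + 1)) = fun q =>
      M.c * ∑ j ∈ Finset.range (k + 1), M.predict (clamp q) j +
        M.sampleMean V (clamp (M.predict (clamp q) k)) := by
    ext q
    rw [hV.waitCost_succ (clamp_mem q), clamp_of_mem (M.predict_mem (clamp_mem q) k)]
  have m1 : ∀ j, Measurable fun q => M.predict q j := by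
    intro j; simp_rw [predict_eq]; fun_prop
  have m2 := hV.measurable_sampleMean (M := M)
  rw [e]
  refine Measurable.add ?_ ?_
  · exact (Finset.measurable_fun_sum _ fun j _ => (m1 j).comp measurable_clamp).const_mul _
  · exact m2.comp ((m1 k).comp measurable_clamp)

theorem measurable_blindCost (m : ℕ) : Measurable fun q => M.blindCost q m := by
  unfold blindCost; simp_rw [predict_eq]; fun_prop

theorem IsValue.isValue_G (hV : IsValue V) : IsValue (M.G V) where
  measurable := by
    unfold G
    refine Measurable.min (by fun_prop) ?_
    exact Measurable.iInf fun m : Set.Ici (1 : ℕ) => hV.measurable_waitCost m.2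
  nonneg q hq := by
    refine le_min (by linarith [hq.2]) (Real.iInf_nonneg ?_)
    rintro ⟨m, hm⟩
    obtain ⟨k, rfl⟩ := Nat.exists_eq_add_of_le' (Set.mem_Ici.1 hm)
    exact hV.waitCost_nonneg hq k
  le q hq := min_le_left _ _

variable (M)

theorem isValue_V (n : ℕ) : IsValue (M.V n) := by
  induction n with
  | zero =>
    refine ⟨?_, fun q hq => Real.iInf_nonneg fun m => blindCost_nonneg hq m, fun q hq => ?_⟩
    · unfold Model.V
      exact Measurable.iInf fun m => (measurable_blindCost m).comp measurable_clamp
    · rw [← blindCost_zero (M := M)]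
      exact ciInf_le ⟨0, by rintro _ ⟨m, rfl⟩; exact blindCost_nonneg hq m⟩ 0
  | succ n ih => exact ih.isValue_G

variable {M}

theorem V_zero_le {q : ℝ} (hq : q ∈ Set.Icc (0 : ℝ) 1) (m : ℕ) : M.V 0 q ≤ M.blindCost q m :=
  ciInf_le ⟨0, by rintro _ ⟨m, rfl⟩; exact blindCost_nonneg hq m⟩ m

theorem V_zero_eq {q : ℝ} (hq : q ∈ Set.Icc (0 : ℝ) 1) {m : ℕ} (hm : m ∈ M.blindArgmin q) :
    M.V 0 q = M.blindCost q m :=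
  le_antisymm (V_zero_le hq m) (le_ciInf hm)

theorem V_succ_le {q : ℝ} (hq : q ∈ Set.Icc (0 : ℝ) 1) (n k : ℕ) :
    M.V (n + 1) q ≤ M.waitCost (M.V n) q (k + 1) :=
  (min_le_right _ _).trans (ciInf_le ((M.isValue_V n).bddBelow_waitCost hq)
    (⟨k + 1, by simp⟩ : Set.Ici (1 : ℕ)))

/-- Waiting one slot without observation does not decrease the expected cost. -/
theorem V_le_wait {q : ℝ} (hq : q ∈ Set.Icc (0 : ℝ) 1) (n : ℕ) :
    M.V n q ≤ M.c * q + M.V n (M.Φ₀ q) := by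
  have hq' := M.Φ₀_mem hq
  cases n with
  | zero =>
    obtain ⟨m, hm⟩ := blindArgmin_nonempty (M := M) hq'
    rw [V_zero_eq hq' hm, ← blindCost_succ]
    exact V_zero_le hq _
  | succ n =>
    have hV := M.isValue_V n
    have h : M.c * q + M.V (n + 1) (M.Φ₀ q) = min (M.c * q + (1 - M.Φ₀ q))
        (M.c * q + ⨅ m : Set.Ici (1 : ℕ), M.waitCost (M.V n) (M.Φ₀ q) m) :=
      (min_add_add_left _ _ _).symm
    rw [h]
    refine le_min ?_ ?_
    -- If the best continuation from `Φ₀ q` is to stop at once, sampling in the slot just waited is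
    -- no worse.
    · refine (V_succ_le hq n 0).trans ?_
      rw [hV.waitCost_one hq]
      linarith [hV.sampleMean_le (M := M) hq]
    · obtain ⟨m, hm⟩ := hV.waitArgmin_nonempty (M := M) hq'
      rw [hV.iInf_waitCost_eq hq' hm]
      obtain ⟨k, rfl⟩ := Nat.exists_eq_add_of_le' hm.1
      rw [← hV.waitCost_succ_succ hq]
      exact V_succ_le hq n _

/-- Sampling in the next slot does not decrease the expected cost. -/
theorem V_le_sample {q : ℝ} (hq : q ∈ Set.Icc (0 : ℝ) 1) (n : ℕ) :
    M.V (n + 1) q ≤ M.c * q + M.sampleMean (M.V n) q := by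
  rw [← (M.isValue_V n).waitCost_one hq]
  exact V_succ_le hq n 0

/-- The value is at most `c q` plus the value at `Φ₀ q`, which is at most the cost of the wait of `k
+ 2` slots. If the two ends agree, both inequalities are equalities. -/
theorem V_eq_wait {q : ℝ} (hq : q ∈ Set.Icc (0 : ℝ) 1) {n k : ℕ}
    (h : M.V (n + 1) q = M.waitCost (M.V n) q (k + 2)) :
    M.V (n + 1) q = M.c * q + M.V (n + 1) (M.Φ₀ q) ∧
      M.V (n + 1) (M.Φ₀ q) = M.waitCost (M.V n) (M.Φ₀ q) (k + 1) := by
  rw [(M.isValue_V n).waitCost_succ_succ hq] at h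
  have h1 := V_le_wait (M := M) hq (n + 1)
  have h2 := V_succ_le (M := M) (M.Φ₀_mem hq) n k
  constructor <;> linarith

theorem V_eq_blind {q : ℝ} (hq : q ∈ Set.Icc (0 : ℝ) 1) {k : ℕ}
    (h : M.V 0 q = M.blindCost q (k + 1)) :
    M.V 0 q = M.c * q + M.V 0 (M.Φ₀ q) ∧ M.V 0 (M.Φ₀ q) = M.blindCost (M.Φ₀ q) k := by
  rw [blindCost_succ] at h
  have h1 := V_le_wait (M := M) hq 0
  have h2 := V_zero_le (M := M) (M.Φ₀_mem hq) k
  constructor <;> linarith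

end Model

end LimitedSampling

end

/-! ### Filtering: the recursion `post` is the posterior of every causal strategy. -/

noncomputable section

namespace LimitedSampling

/-- A strategy is causal if every decision is a function of the observations made so far. -/
def Causal (μ : ℕ → Sample → Bool) : Prop := ∀ k, Measurable[info μ k] (μ (k + 1))

theorem info_succ (μ : ℕ → Sample → Bool) (k : ℕ) :
    info μ (k + 1) = info μ k ⊔ MeasurableSpace.comap (obs μ (k + 1)) inferInstance := by
  apply le_antisymm
  · refine iSup₂_le fun j hj => ?_
    rcases (Finset.mem_Icc.1 hj).2.eq_or_lt with rfl | h
    · exact le_sup_right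
    · exact le_sup_of_le_left (le_iSup₂_of_le j
        (Finset.mem_Icc.2 ⟨(Finset.mem_Icc.1 hj).1, by omega⟩) le_rfl)
  · refine sup_le (iSup₂_le fun j hj => ?_) ?_
    · have := Finset.mem_Icc.1 hj
      exact le_iSup₂_of_le j (Finset.mem_Icc.2 ⟨this.1, by omega⟩) le_rfl
    · exact le_iSup₂_of_le (k + 1) (Finset.mem_Icc.2 ⟨by omega, le_rfl⟩) le_rfl

theorem info_zero (μ : ℕ → Sample → Bool) : info μ 0 = ⊥ := by simp [info]

theorem info_mono (μ : ℕ → Sample → Bool) {j k : ℕ} (h : j ≤ k) : info μ j ≤ info μ k :=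
  monotone_nat_of_le_succ (f := info μ) (fun k => by rw [info_succ]; exact le_sup_left) h

theorem measurable_obs_info (μ : ℕ → Sample → Bool) (k : ℕ) :
    Measurable[info μ (k + 1)] (obs μ (k + 1)) := by
  rw [measurable_iff_comap_le, info_succ]
  exact le_sup_right

variable {μ : ℕ → Sample → Bool}

/-- The σ-algebra `past k` does not depend on the strategy, so the product structure of `P` can be
used for all causal strategies at once. -/
theorem Causal.info_le_past (hμ : Causal μ) (k : ℕ) : info μ k ≤ past k := by
  induction k with
  | zero => rw [info_zero]; exact bot_le
  | succ k ih =>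
    rw [info_succ]
    refine sup_le (ih.trans (past_mono k.le_succ)) ?_
    rw [← measurable_iff_comap_le]
    refine Measurable.ite ?_ ?_ measurable_const
    · exact (ih.trans (past_mono k.le_succ)) _ (hμ k (measurableSet_singleton true))
    · exact measurable_inl.comp (measurable_X_past le_rfl)

theorem Causal.info_le (hμ : Causal μ) (k : ℕ) :
    info μ k ≤ (inferInstance : MeasurableSpace Sample) :=
  (hμ.info_le_past k).trans (past_le k)

theorem Causal.measurableSet_sample (hμ : Causal μ) (k : ℕ) :
    MeasurableSet[info μ k] {ω | μ (k + 1) ω = true} :=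
  hμ k (measurableSet_singleton true)

/-- The value observed at slot `k`, or `0` if there is none. -/
def obsVal (μ : ℕ → Sample → Bool) (k : ℕ) (ω : Sample) : ℝ :=
  Sum.elim id (fun _ => 0) (obs μ k ω)

theorem obsVal_eq {k : ℕ} {ω : Sample} (h : μ k ω = true) : obsVal μ k ω = X k ω := by
  simp [obsVal, obs, h]

theorem measurable_obsVal (μ : ℕ → Sample → Bool) (k : ℕ) :
    Measurable[info μ (k + 1)] (obsVal μ (k + 1)) :=
  (measurable_id.sumElim measurable_const).comp (measurable_obs_info μ k)

/-- These intersections form a π-system, on which Bayes' rule is checked in `filter`. -/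
theorem info_succ_eq_generateFrom (μ : ℕ → Sample → Bool) (k : ℕ) :
    info μ (k + 1) = MeasurableSpace.generateFrom
      {S | ∃ A B, MeasurableSet[info μ k] A ∧ MeasurableSet B ∧ S = A ∩ obs μ (k + 1) ⁻¹' B} := by
  rw [info_succ]
  apply le_antisymm
  · refine sup_le ?_ ?_
    · intro A hA
      exact MeasurableSpace.measurableSet_generateFrom
        ⟨A, Set.univ, hA, MeasurableSet.univ, by simp⟩
    · rintro _ ⟨B, hB, rfl⟩
      exact MeasurableSpace.measurableSet_generateFrom
        ⟨Set.univ, B, MeasurableSet.univ, hB, by simp⟩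
  · refine MeasurableSpace.generateFrom_le ?_
    rintro _ ⟨A, B, hA, hB, rfl⟩
    exact MeasurableSet.inter ((le_sup_left : info μ k ≤ _) _ hA)
      ((le_sup_right : MeasurableSpace.comap (obs μ (k + 1)) inferInstance ≤ _) _ ⟨B, hB, rfl⟩)

section Trim

variable {Ω : Type*} {m m₀ : MeasurableSpace Ω} {P : Measure Ω}

/-- The hypothesis says that `P` restricted to `D` and `P` with density `g` agree on `m`; hence they
give the same integrals to `m`-measurable functions. -/
theorem setLIntegral_inter_of_forall_measure (hm : m ≤ m₀) {D : Set Ω} {g : Ω → ℝ≥0∞}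
    (hg : Measurable[m₀] g) (h : ∀ A, MeasurableSet[m] A → P (A ∩ D) = ∫⁻ ω in A, g ω ∂P)
    {A : Set Ω} (hA : MeasurableSet[m] A) {H : Ω → ℝ≥0∞} (hH : Measurable[m] H) :
    ∫⁻ ω in A ∩ D, H ω ∂P = ∫⁻ ω in A, g ω * H ω ∂P := by
  have key : (P.restrict D).trim hm = (P.withDensity g).trim hm := by
    refine @Measure.ext _ m _ _ fun B hB => ?_
    rw [trim_measurableSet_eq hm hB, trim_measurableSet_eq hm hB,
      Measure.restrict_apply (hm _ hB), withDensity_apply _ (hm _ hB), h B hB]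
  have hH' : Measurable[m] (A.indicator H) := hH.indicator hA
  have h1 : ∫⁻ ω in D, A.indicator H ω ∂P = ∫⁻ ω, A.indicator H ω ∂P.withDensity g := by
    rw [← lintegral_trim hm hH', ← lintegral_trim hm hH', key]
  rw [lintegral_indicator (hm _ hA), Measure.restrict_restrict (hm _ hA),
    lintegral_withDensity_eq_lintegral_mul _ hg (hH'.mono hm le_rfl)] at h1
  rw [h1, ← lintegral_indicator (hm _ hA)]
  congr 1; ext ω
  by_cases hω : ω ∈ A <;> simp [hω]

theorem measure_inter_compl_of_forall_measure [IsFiniteMeasure P] {D : Set Ω}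
    (hD : MeasurableSet D) {g : Ω → ℝ} (hg : Measurable g) (hg' : ∀ ω, g ω ∈ Set.Icc (0 : ℝ) 1)
    {A : Set Ω} (h : P (A ∩ D) = ∫⁻ ω in A, ENNReal.ofReal (g ω) ∂P) :
    P (A ∩ Dᶜ) = ∫⁻ ω in A, ENNReal.ofReal (1 - g ω) ∂P := by
  have h1 : P (A ∩ D) + P (A ∩ Dᶜ) = P A := by
    rw [← Set.sdiff_eq]; exact measure_inter_add_sdiff A hD
  have h2 : ∫⁻ ω in A, ENNReal.ofReal (g ω) ∂P + ∫⁻ ω in A, ENNReal.ofReal (1 - g ω) ∂P = P A := by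
    rw [← lintegral_add_left hg.ennreal_ofReal]
    have : ∀ ω, ENNReal.ofReal (g ω) + ENNReal.ofReal (1 - g ω) = 1 := fun ω => by
      rw [← ENNReal.ofReal_add (hg' ω).1 (by linarith [(hg' ω).2])]; simp
    simp [this]
  rw [← h, ← h1] at h2
  exact ((ENNReal.add_right_inj (measure_ne_top P _)).1 h2).symm

end Trim

namespace Model

variable (M : Model)

/-- The posterior process, computed recursively from the observations. -/
def post (p : ℝ) (μ : ℕ → Sample → Bool) : ℕ → Sample → ℝ
  | 0, _ => p
  | k + 1, ω => if μ (k + 1) ω = true then M.Φ₁ (X (k + 1) ω) (post p μ k ω)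
      else M.Φ₀ (post p μ k ω)

variable {M} {p : ℝ}

theorem post_mem (hp : p ∈ Set.Icc (0 : ℝ) 1) (μ : ℕ → Sample → Bool) (k : ℕ) (ω : Sample) :
    M.post p μ k ω ∈ Set.Icc (0 : ℝ) 1 := by
  induction k with
  | zero => exact hp
  | succ k ih =>
    rw [post]; split_ifs
    · exact M.Φ₁_mem ih _
    · exact M.Φ₀_mem ih

theorem measurable_post_info (hμ : Causal μ) (k : ℕ) : Measurable[info μ k] (M.post p μ k) := by
  induction k with
  | zero => exact measurable_const
  | succ k ih =>
    have ih' : Measurable[info μ (k + 1)] (M.post p μ k) := ih.mono (info_mono μ k.le_succ) le_rfl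
    -- `X (k + 1)` need not be measurable for the information; `obsVal` is, and agrees with it
    -- whenever a sample is taken.
    have e : M.post p μ (k + 1) = fun ω => if μ (k + 1) ω = true then
        M.Φ₁ (obsVal μ (k + 1) ω) (M.post p μ k ω) else M.Φ₀ (M.post p μ k ω) := by
      ext ω
      rw [post]
      split_ifs with h
      · rw [obsVal_eq h]
      · rfl
    rw [e]
    refine Measurable.ite (info_mono μ k.le_succ _ (hμ.measurableSet_sample k)) ?_ ?_
    · exact M.measurable_Φ₁.comp ((measurable_obsVal μ k).prodMk ih')
    · exact M.measurable_Φ₀.comp ih'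

theorem measurable_post (hμ : Causal μ) (k : ℕ) : Measurable (M.post p μ k) :=
  (measurable_post_info hμ k).mono (hμ.info_le k) le_rfl

theorem measurableSet_Λ_le (k : ℕ) : MeasurableSet {ω | Λ ω ≤ k} := measurable_Λ measurableSet_Iic

/-- The change has occurred by `k`, or it occurs at `k + 1` with hazard `ρ`. The hypothesis `h` is
the induction hypothesis of `filter`. -/
theorem predict_of_filter (hp : p ∈ Set.Icc (0 : ℝ) 1) (hμ : Causal μ) {k : ℕ}
    (h : ∀ A, MeasurableSet[info μ k] A →
      M.P p (A ∩ {ω | Λ ω ≤ k}) = ∫⁻ ω in A, ENNReal.ofReal (M.post p μ k ω) ∂M.P p)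
    {A : Set Sample} (hA : MeasurableSet[info μ k] A) :
    M.P p (A ∩ {ω | Λ ω ≤ k + 1}) =
      ∫⁻ ω in A, ENNReal.ofReal (M.Φ₀ (M.post p μ k ω)) ∂M.P p := by
  have := M.isProbabilityMeasure_P hp
  have hm := measurable_post (M := M) (p := p) hμ k
  have e : A ∩ {ω | Λ ω ≤ k + 1} = (A ∩ {ω | Λ ω ≤ k}) ∪ (A ∩ {ω | Λ ω = k + 1}) := by
    ext ω; simp only [Set.mem_inter_iff, Set.mem_ofPred_eq, Set.mem_union, Nat.le_succ_iff]; tauto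
  rw [e, measure_union, M.P_inter_eq hp (hμ.info_le_past k _ hA), h A hA,
    measure_inter_compl_of_forall_measure (measurableSet_Λ_le k) hm (post_mem hp μ k) (h A hA),
    ← lintegral_const_mul _ (by fun_prop), ← lintegral_add_left (by fun_prop)]
  · congr 1; ext ω
    obtain ⟨h0, h1⟩ := post_mem (M := M) hp μ k ω
    rw [← ENNReal.ofReal_mul M.ρ_pos.le, ← ENNReal.ofReal_add h0
      (mul_nonneg M.ρ_pos.le (by linarith)), Φ₀]
    congr 1; ring
  · refine Set.disjoint_left.2 fun ω h1 h2 => ?_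
    have h1 := h1.2; have h2 := h2.2
    simp only [Set.mem_ofPred_eq] at h1 h2
    omega
  · exact (hμ.info_le k _ hA).inter (measurable_Λ (measurableSet_singleton _))

/-- Split according to `Λ ≤ k + 1`: the next observation has density `f₁` or `f₀`, and the
conditional weights of the two events are those of `mix`. -/
theorem lintegral_next_of_filter {E : Type*} [MeasurableSpace E] (hp : p ∈ Set.Icc (0 : ℝ) 1)
    (hμ : Causal μ) {k : ℕ}
    (h : ∀ A, MeasurableSet[info μ k] A →
      M.P p (A ∩ {ω | Λ ω ≤ k}) = ∫⁻ ω in A, ENNReal.ofReal (M.post p μ k ω) ∂M.P p)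
    {A : Set Sample} (hA : MeasurableSet[info μ k] A) {T : Sample → E}
    (hT : Measurable[info μ k] T) {G : E → ℝ → ℝ≥0∞} (hG : Measurable (Function.uncurry G)) :
    ∫⁻ ω in A, G (T ω) (X (k + 1) ω) ∂M.P p =
      ∫⁻ ω in A, ∫⁻ y, G (T ω) y ∂M.mix (M.post p μ k ω) ∂M.P p := by
  have := M.isProbabilityMeasure_P hp
  have hm := (M.measurable_Φ₀).comp (measurable_post (M := M) (p := p) hμ k)
  have hD := measurableSet_Λ_le (k + 1)
  have hA' := hμ.info_le_past k _ hA
  have hT' := hT.mono (hμ.info_le_past k) le_rfl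
  have hpred := fun A hA => predict_of_filter hp hμ h (A := A) hA
  have hpred' := fun A hA => measure_inter_compl_of_forall_measure hD hm
    (fun ω => M.Φ₀_mem (post_mem hp μ k ω)) (hpred A hA)
  have hH : ∀ f : PDF, Measurable[info μ k] fun ω => ∫⁻ y, G (T ω) y ∂f.law := fun f =>
    (hG.lintegral_prod_right' (ν := f.law)).comp hT
  rw [← lintegral_inter_add_sdiff _ _ hD, Set.sdiff_eq, M.lintegral_next_le hp hA' hT' hG,
    M.lintegral_next_gt hp hA' hT' hG,
    setLIntegral_inter_of_forall_measure (hμ.info_le k) hm.ennreal_ofReal hpred hA (hH _),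
    setLIntegral_inter_of_forall_measure (hμ.info_le k) (by fun_prop) hpred' hA (hH _),
    ← lintegral_add_left]
  · simp_rw [lintegral_mix]
    rfl
  · exact hm.ennreal_ofReal.mul ((hH _).mono (hμ.info_le k) le_rfl)

/-- Bayes' rule: the recursion computes the conditional probability of `Λ ≤ k`. -/
theorem filter (hp : p ∈ Set.Icc (0 : ℝ) 1) (hμ : Causal μ) (k : ℕ) :
    ∀ A, MeasurableSet[info μ k] A →
      M.P p (A ∩ {ω | Λ ω ≤ k}) = ∫⁻ ω in A, ENNReal.ofReal (M.post p μ k ω) ∂M.P p := by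
  have := M.isProbabilityMeasure_P hp
  induction k with
  | zero =>
    intro A hA
    rw [info_zero, MeasurableSpace.measurableSet_bot_iff] at hA
    rcases hA with rfl | rfl
    · simp
    · have h := prob_compl_eq_one_sub (μ := M.P p) (measurableSet_Λ_le 0).compl
      rw [compl_compl, M.P_gt_eq hp, predict_zero, ← ENNReal.ofReal_one,
        ← ENNReal.ofReal_sub _ (by linarith [hp.2]), sub_sub_cancel] at h
      rw [Set.univ_inter, h]; simp [post]
  | succ k ih =>
    have hD := measurableSet_Λ_le (k + 1)
    set U := {ω | μ (k + 1) ω = true} with hU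
    have hUi : MeasurableSet[info μ k] U := hμ.measurableSet_sample k
    have hUm : MeasurableSet U := hμ.info_le k _ hUi
    have hmp : Measurable fun ω => ENNReal.ofReal (M.Φ₀ (M.post p μ k ω)) :=
      (M.measurable_Φ₀.comp (measurable_post hμ k)).ennreal_ofReal
    -- Bayes' rule on a generating event, treated separately where a sample is taken and where it is
    -- not.
    have key : ∀ A B, MeasurableSet[info μ k] A → MeasurableSet B →
        M.P p ((A ∩ obs μ (k + 1) ⁻¹' B) ∩ {ω | Λ ω ≤ k + 1}) =
          ∫⁻ ω in A ∩ obs μ (k + 1) ⁻¹' B, ENNReal.ofReal (M.post p μ (k + 1) ω) ∂M.P p := by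
      intro A B hA hB
      set C : Set ℝ := Sum.inl ⁻¹' B with hC
      have hCm : MeasurableSet C := measurable_inl hB
      have hAU : MeasurableSet[info μ k] (A ∩ U) := MeasurableSet.inter hA hUi
      have hAU' : MeasurableSet[info μ k] (A ∩ Uᶜ) := MeasurableSet.inter hA hUi.compl
      rw [← measure_inter_add_sdiff _ hUm, ← lintegral_inter_add_sdiff _ _ hUm]
      congr 1
      · have e1 : A ∩ obs μ (k + 1) ⁻¹' B ∩ {ω | Λ ω ≤ k + 1} ∩ U =
            (A ∩ U) ∩ X (k + 1) ⁻¹' C ∩ {ω | Λ ω ≤ k + 1} := by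
          ext ω
          by_cases h : μ (k + 1) ω = true <;> simp [obs, hU, hC, h]
        have e2 : A ∩ obs μ (k + 1) ⁻¹' B ∩ U = (A ∩ U) ∩ X (k + 1) ⁻¹' C := by
          ext ω
          by_cases h : μ (k + 1) ω = true <;> simp [obs, hU, hC, h]
        have hG : Measurable (Function.uncurry fun q y : ℝ =>
            ENNReal.ofReal (M.Φ₁ y q) * C.indicator 1 y) := by
          have h1 : Measurable fun z : ℝ × ℝ => M.Φ₁ z.2 z.1 :=
            M.measurable_Φ₁.comp measurable_swap
          have h2 : Measurable fun z : ℝ × ℝ => C.indicator (1 : ℝ → ℝ≥0∞) z.2 :=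
            (measurable_one.indicator hCm).comp measurable_snd
          exact h1.ennreal_ofReal.mul h2
        have h3 : ∫⁻ ω in A ∩ U ∩ X (k + 1) ⁻¹' C, ENNReal.ofReal (M.post p μ (k + 1) ω) ∂M.P p =
            ∫⁻ ω in A ∩ U, ENNReal.ofReal (M.Φ₁ (X (k + 1) ω) (M.post p μ k ω)) *
              C.indicator 1 (X (k + 1) ω) ∂M.P p := by
          rw [Set.inter_comm, ← Measure.restrict_restrict (measurable_X _ hCm),
            ← lintegral_indicator (measurable_X _ hCm)]
          refine setLIntegral_congr_fun (hμ.info_le k _ hAU) fun ω hω => ?_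
          have hω2 : μ (k + 1) ω = true := hω.2
          by_cases hX : X (k + 1) ω ∈ C
          · simp [hX, post, hω2]
          · simp [hX]
        rw [e1, e2, M.P_inter_le p (hμ.info_le_past k _ hAU) hCm, predict_of_filter hp hμ ih hAU,
          h3, lintegral_next_of_filter hp hμ ih hAU (measurable_post_info hμ k) hG,
          ← lintegral_mul_const _ hmp]
        congr 1; ext ω
        rw [M.lintegral_mix_Φ₁ (post_mem hp μ k ω) (measurable_one.indicator hCm)]
        simp [lintegral_indicator hCm]
      -- Without a sample the observation is a constant symbol, so the condition on it holds
      -- everywhere or nowhere.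
      · by_cases hB' : Sum.inr () ∈ B
        · have e1 : (A ∩ obs μ (k + 1) ⁻¹' B ∩ {ω | Λ ω ≤ k + 1}) \ U =
              (A ∩ Uᶜ) ∩ {ω | Λ ω ≤ k + 1} := by
            ext ω
            by_cases h : μ (k + 1) ω = true <;> simp [obs, hU, h, hB']
          have e2 : (A ∩ obs μ (k + 1) ⁻¹' B) \ U = A ∩ Uᶜ := by
            ext ω
            by_cases h : μ (k + 1) ω = true <;> simp [obs, hU, h, hB']
          rw [e1, e2, predict_of_filter hp hμ ih hAU']
          refine setLIntegral_congr_fun (hμ.info_le k _ hAU') fun ω hω => ?_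
          have hω2 : ¬ μ (k + 1) ω = true := hω.2
          simp only [post, if_neg hω2]
        · have e1 : (A ∩ obs μ (k + 1) ⁻¹' B ∩ {ω | Λ ω ≤ k + 1}) \ U = ∅ := by
            ext ω
            by_cases h : μ (k + 1) ω = true <;> simp [obs, hU, h, hB']
          have e2 : (A ∩ obs μ (k + 1) ⁻¹' B) \ U = ∅ := by
            ext ω
            by_cases h : μ (k + 1) ω = true <;> simp [obs, hU, h, hB']
          rw [e1, e2]; simp
    intro A hA
    have hle := hμ.info_le (k + 1)
    have hfin : IsFiniteMeasure ((M.P p).restrict {ω | Λ ω ≤ k + 1}) := inferInstance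
    have hpi : IsPiSystem {S | ∃ A B, MeasurableSet[info μ k] A ∧ MeasurableSet B ∧
        S = A ∩ obs μ (k + 1) ⁻¹' B} := by
      rintro _ ⟨A, B, hA, hB, rfl⟩ _ ⟨A', B', hA', hB', rfl⟩ _
      refine ⟨A ∩ A', B ∩ B', MeasurableSet.inter hA hA', hB.inter hB', ?_⟩
      ext ω; simp; tauto
    -- Both sides are finite measures of `A`; they agree on the π-system and on the whole space.
    have := ext_on_measurableSpace_of_generate_finite _
      (μ := (M.P p).restrict {ω | Λ ω ≤ k + 1})
      (ν := (M.P p).withDensity fun ω => ENNReal.ofReal (M.post p μ (k + 1) ω)) _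
      ?_ hle (info_succ_eq_generateFrom μ k) hpi ?_ hA
    · rwa [Measure.restrict_apply (hle _ hA), withDensity_apply _ (hle _ hA)] at this
    · rintro _ ⟨A, B, hA, hB, rfl⟩
      have hS : MeasurableSet (A ∩ obs μ (k + 1) ⁻¹' B) :=
        (hμ.info_le k _ hA).inter (hle _ (measurable_obs_info μ k hB))
      rw [Measure.restrict_apply hS, withDensity_apply _ hS, key A B hA hB]
    · have := key Set.univ Set.univ MeasurableSet.univ MeasurableSet.univ
      simpa using this

theorem filter_compl (hp : p ∈ Set.Icc (0 : ℝ) 1) (hμ : Causal μ) (k : ℕ) (A : Set Sample)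
    (hA : MeasurableSet[info μ k] A) :
    M.P p (A ∩ {ω | Λ ω ≤ k}ᶜ) = ∫⁻ ω in A, ENNReal.ofReal (1 - M.post p μ k ω) ∂M.P p := by
  have := M.isProbabilityMeasure_P hp
  exact measure_inter_compl_of_forall_measure (measurableSet_Λ_le k) (measurable_post hμ k)
    (post_mem hp μ k) (filter hp hμ k A hA)

theorem lintegral_next {E : Type*} [MeasurableSpace E] (hp : p ∈ Set.Icc (0 : ℝ) 1)
    (hμ : Causal μ) {k : ℕ} {A : Set Sample} (hA : MeasurableSet[info μ k] A) {T : Sample → E}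
    (hT : Measurable[info μ k] T) {G : E → ℝ → ℝ≥0∞} (hG : Measurable (Function.uncurry G)) :
    ∫⁻ ω in A, G (T ω) (X (k + 1) ω) ∂M.P p =
      ∫⁻ ω in A, ∫⁻ y, G (T ω) y ∂M.mix (M.post p μ k ω) ∂M.P p :=
  lintegral_next_of_filter hp hμ (filter hp hμ k) hA hT hG

theorem posterior_ae_eq (hp : p ∈ Set.Icc (0 : ℝ) 1) (hμ : Causal μ) (k : ℕ) :
    M.posterior p μ k =ᵐ[M.P p] M.post p μ k := by
  have := M.isProbabilityMeasure_P hp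
  have hle := hμ.info_le k
  have hi : Integrable (M.post p μ k) (M.P p) :=
    Integrable.of_mem_Icc 0 1 (measurable_post hμ k).aemeasurable (ae_of_all _ (post_mem hp μ k))
  have hD := measurableSet_Λ_le k
  refine (ae_eq_condExp_of_forall_setIntegral_eq hle ?_ (fun _ _ _ => hi.integrableOn) ?_ ?_).symm
  · exact (integrable_const (1 : ℝ)).indicator hD
  · intro A hA _
    rw [integral_eq_lintegral_of_nonneg_ae (ae_of_all _ fun ω => (post_mem hp μ k ω).1)
      (measurable_post hμ k).aestronglyMeasurable, ← filter hp hμ k A hA,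
      setIntegral_indicator hD]
    simp [Measure.real]
  · exact (measurable_post_info hμ k).stronglyMeasurable.aestronglyMeasurable

theorem ae_forall_posterior_eq (hp : p ∈ Set.Icc (0 : ℝ) 1) (hμ : Causal μ) :
    ∀ᵐ ω ∂M.P p, ∀ k, M.posterior p μ k ω = M.post p μ k ω :=
  ae_all_iff.2 fun k => posterior_ae_eq hp hμ k

end Model

end LimitedSampling

end

/-! ### Verification: telescoping the dynamic program. -/

noncomputable section

namespace LimitedSampling

variable {μ : ℕ → Sample → Bool} {τ : Sample → ℕ∞} {n : ℕ}

/-- The number of sampling rights left, as a natural number. -/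
def rights (n : ℕ) (μ : ℕ → Sample → Bool) (k : ℕ) (ω : Sample) : ℕ := (rightsLeft n μ k ω).toNat

theorem rightsLeft_succ (n : ℕ) (μ : ℕ → Sample → Bool) (k : ℕ) (ω : Sample) :
    rightsLeft n μ (k + 1) ω = rightsLeft n μ k ω - if μ (k + 1) ω = true then 1 else 0 := by
  rw [rightsLeft, rightsLeft, Finset.sum_Icc_succ_top (by omega)]; ring

theorem rights_zero (n : ℕ) (μ : ℕ → Sample → Bool) (ω : Sample) : rights n μ 0 ω = n := by
  simp [rights, rightsLeft]

theorem Causal.measurable_rightsLeft (hμ : Causal μ) (n k : ℕ) :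
    Measurable[info μ k] (rightsLeft n μ k) := by
  induction k with
  | zero =>
    have : rightsLeft n μ 0 = fun _ => (n : ℤ) := by ext ω; simp [rightsLeft]
    rw [this]; exact measurable_const
  | succ k ih =>
    have e : rightsLeft n μ (k + 1) = fun ω =>
        rightsLeft n μ k ω - if μ (k + 1) ω = true then 1 else 0 := by
      ext ω; exact rightsLeft_succ n μ k ω
    rw [e]
    exact (ih.sub (Measurable.ite (hμ.measurableSet_sample k) measurable_const
      measurable_const)).mono (info_mono μ k.le_succ) le_rfl

theorem Causal.measurable_rights (hμ : Causal μ) (n k : ℕ) :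
    Measurable[info μ k] (rights n μ k) :=
  (measurable_from_top (f := Int.toNat)).comp (hμ.measurable_rightsLeft n k)

namespace Admissible

theorem causal' (h : Admissible n μ τ) : Causal μ := h.causal

theorem rights_of_sample (h : Admissible n μ τ) {k : ℕ} {ω : Sample} (hk : μ (k + 1) ω = true) :
    rights n μ k ω = rights n μ (k + 1) ω + 1 := by
  have h1 := h.rights_nonneg (k + 1) ω
  rw [rightsLeft_succ, if_pos hk] at h1
  rw [rights, rights, rightsLeft_succ, if_pos hk]
  omega

theorem rights_of_not_sample (_ : Admissible n μ τ) {k : ℕ} {ω : Sample}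
    (hk : ¬ μ (k + 1) ω = true) : rights n μ (k + 1) ω = rights n μ k ω := by
  rw [rights, rights, rightsLeft_succ, if_neg hk, sub_zero]

theorem measurableSet_lt (h : Admissible n μ τ) (k : ℕ) :
    MeasurableSet[info μ k] {ω | (k : ℕ∞) < τ ω} := by
  have : {ω | (k : ℕ∞) < τ ω} = {ω | τ ω ≤ (k : ℕ∞)}ᶜ := by ext ω; simp
  rw [this]; exact (h.stopping k).compl

theorem measurableSet_ge (h : Admissible n μ τ) (k : ℕ) :
    MeasurableSet[info μ k] {ω | (k : ℕ∞) ≤ τ ω} := by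
  cases k with
  | zero => simp
  | succ k =>
    have : {ω | ((k + 1 : ℕ) : ℕ∞) ≤ τ ω} = {ω | (k : ℕ∞) < τ ω} := by
      ext ω; simp [ENat.add_one_le_iff]
    rw [this]; exact info_mono μ k.le_succ _ (h.measurableSet_lt k)

theorem measurableSet_eq (h : Admissible n μ τ) (k : ℕ) :
    MeasurableSet[info μ k] {ω | τ ω = (k : ℕ∞)} := by
  have : {ω | τ ω = (k : ℕ∞)} = {ω | τ ω ≤ (k : ℕ∞)} ∩ {ω | (k : ℕ∞) ≤ τ ω} := by
    ext ω; simp [le_antisymm_iff]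
  rw [this]; exact MeasurableSet.inter (h.stopping k) (h.measurableSet_ge k)

end Admissible

/-- Counting the slots from `l` up to `t` turns the delay into a sum over time, whose terms can be
conditioned one slot at a time. -/
theorem tsum_delay {c : ℝ≥0∞} (hc : c ≠ 0) (t : ℕ∞) (l : ℕ) :
    ∑' k : ℕ, (if (k : ℕ∞) < t ∧ l ≤ k then c else 0) = c * ((t : ℝ≥0∞) - (l : ℝ≥0∞)) := by
  cases t with
  | top =>
    rw [ENat.toENNReal_top, ENNReal.top_sub (ENNReal.natCast_ne_top l), ENNReal.mul_top hc,
      ← ENNReal.summable.sum_add_tsum_nat_add' (k := l)]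
    have : ∀ k : ℕ, (if ((k + l : ℕ) : ℕ∞) < ⊤ ∧ l ≤ k + l then c else 0) = c := fun k => by
      rw [if_pos ⟨ENat.natCast_lt_top _, by omega⟩]
    simp_rw [this]
    rw [ENNReal.tsum_const_eq_top_of_ne_zero hc, add_top]
  | coe t =>
    rw [tsum_eq_sum (s := Finset.Ico l t), Finset.sum_congr rfl (g := fun _ => c)]
    · rw [Finset.sum_const, Nat.card_Ico, nsmul_eq_mul, mul_comm, ENat.toENNReal_coe,
        ENNReal.natCast_sub]
    · intro k hk
      have := Finset.mem_Ico.1 hk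
      rw [if_pos ⟨by exact_mod_cast this.2, this.1⟩]
    · intro k hk
      rw [if_neg]
      rintro ⟨h1, h2⟩
      exact hk (Finset.mem_Ico.2 ⟨h2, by exact_mod_cast h1⟩)

theorem tsum_false_alarm (t : ℕ∞) (l : ℕ) :
    ∑' k : ℕ, (if t = (k : ℕ∞) ∧ ¬ l ≤ k then 1 else 0 : ℝ≥0∞) =
      if t < (l : ℕ∞) then 1 else 0 := by
  cases t with
  | top => simp
  | coe t =>
    rw [tsum_eq_single t]
    · simp
    · intro k hk
      rw [if_neg]
      rintro ⟨h, -⟩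
      exact hk (by exact_mod_cast h.symm)

namespace Model

variable {M : Model} {p : ℝ}

/-- The expected cost incurred at time `k`. -/
def stageCost (M : Model) (p : ℝ) (μ : ℕ → Sample → Bool) (τ : Sample → ℕ∞) (k : ℕ) : ℝ≥0∞ :=
  ∫⁻ ω in {ω | (k : ℕ∞) < τ ω}, ENNReal.ofReal (M.c * M.post p μ k ω) ∂M.P p +
    ∫⁻ ω in {ω | τ ω = (k : ℕ∞)}, ENNReal.ofReal (1 - M.post p μ k ω) ∂M.P p

theorem cost_eq_tsum (M : Model) (t : ℕ∞) (l : ℕ) :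
    (ENNReal.ofReal M.c * ((t : ℝ≥0∞) - (l : ℝ≥0∞)) + if t < (l : ℕ∞) then 1 else 0) =
      ∑' k : ℕ, ((if (k : ℕ∞) < t ∧ l ≤ k then ENNReal.ofReal M.c else 0) +
        (if t = (k : ℕ∞) ∧ ¬ l ≤ k then 1 else 0)) := by
  rw [ENNReal.tsum_add, tsum_delay (by simpa using M.c_pos), tsum_false_alarm]

theorem measurable_cost_term (h : Admissible n μ τ) (k : ℕ) :
    Measurable fun ω => (if (k : ℕ∞) < τ ω ∧ Λ ω ≤ k then ENNReal.ofReal M.c else 0) +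
        (if τ ω = (k : ℕ∞) ∧ ¬ Λ ω ≤ k then 1 else 0 : ℝ≥0∞) := by
  have hle := h.causal'.info_le k
  refine Measurable.add (Measurable.ite ?_ measurable_const measurable_const)
    (Measurable.ite ?_ measurable_const measurable_const)
  · exact (hle _ (h.measurableSet_lt k)).inter (measurableSet_Λ_le k)
  · exact (hle _ (h.measurableSet_eq k)).inter (measurableSet_Λ_le k).compl

/-- At slot `k` the events about `τ` belong to `info μ k`, so `filter` replaces the indicator of `Λ
≤ k` by the posterior. -/
theorem risk_eq_tsum (hp : p ∈ Set.Icc (0 : ℝ) 1) (h : Admissible n μ τ) :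
    M.risk p τ = ∑' k, M.stageCost p μ τ k := by
  unfold risk
  simp_rw [M.cost_eq_tsum]
  rw [lintegral_tsum fun k => (measurable_cost_term h k).aemeasurable]
  congr 1; ext k
  have hle := h.causal'.info_le k
  have hD := measurableSet_Λ_le k
  have h1 := (hle _ (h.measurableSet_lt k)).inter hD
  have h2 := (hle _ (h.measurableSet_eq k)).inter hD.compl
  have e1 : (fun ω => if (k : ℕ∞) < τ ω ∧ Λ ω ≤ k then ENNReal.ofReal M.c else 0) =
      ({ω | (k : ℕ∞) < τ ω} ∩ {ω | Λ ω ≤ k}).indicator fun _ => ENNReal.ofReal M.c := by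
    ext ω; simp [Set.indicator_apply]
  have e2 : (fun ω => if τ ω = (k : ℕ∞) ∧ ¬ Λ ω ≤ k then 1 else 0 : Sample → ℝ≥0∞) =
      ({ω | τ ω = (k : ℕ∞)} ∩ {ω | Λ ω ≤ k}ᶜ).indicator fun _ => 1 := by
    ext ω; simp [Set.indicator_apply]
  rw [lintegral_add_left (by rw [e1]; exact measurable_const.indicator h1), e1, e2,
    lintegral_indicator_const h1, lintegral_indicator_const h2, one_mul,
    filter hp h.causal' k _ (h.measurableSet_lt k),
    filter_compl hp h.causal' k _ (h.measurableSet_eq k), stageCost,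
    ← lintegral_const_mul _ (measurable_post h.causal' k).ennreal_ofReal]
  simp_rw [ENNReal.ofReal_mul M.c_pos.le]

/-- The expected value of the state at time `k`, on the event that sampling has not stopped. -/
def valueAt (M : Model) (p : ℝ) (n : ℕ) (μ : ℕ → Sample → Bool) (τ : Sample → ℕ∞) (k : ℕ) :
    ℝ≥0∞ :=
  ∫⁻ ω in {ω | (k : ℕ∞) ≤ τ ω}, ENNReal.ofReal (M.V (rights n μ k ω) (M.post p μ k ω)) ∂M.P p

/-- The conditional expectation of the value of the next state. -/
def nextValue (M : Model) (p : ℝ) (n : ℕ) (μ : ℕ → Sample → Bool) (k : ℕ) (ω : Sample) : ℝ :=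
  if μ (k + 1) ω = true then M.sampleMean (M.V (rights n μ k ω - 1)) (M.post p μ k ω)
  else M.V (rights n μ k ω) (M.Φ₀ (M.post p μ k ω))

theorem measurable_V_clamp (M : Model) :
    Measurable fun z : ℕ × ℝ => M.V z.1 (clamp z.2) :=
  measurable_from_prod_countable_right fun r => (M.isValue_V r).measurable

theorem valueAt_zero (hp : p ∈ Set.Icc (0 : ℝ) 1) :
    M.valueAt p n μ τ 0 = ENNReal.ofReal (M.V n p) := by
  have := M.isProbabilityMeasure_P hp
  simp [valueAt, rights_zero, post]

theorem valueAt_succ (hp : p ∈ Set.Icc (0 : ℝ) 1) (h : Admissible n μ τ) (k : ℕ) :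
    M.valueAt p n μ τ (k + 1) =
      ∫⁻ ω in {ω | (k : ℕ∞) < τ ω}, ENNReal.ofReal (M.nextValue p n μ k ω) ∂M.P p := by
  have hle := h.causal'.info_le k
  set A := {ω | (k : ℕ∞) < τ ω} with hA
  set U := {ω | μ (k + 1) ω = true} with hU
  have hAi : MeasurableSet[info μ k] A := h.measurableSet_lt k
  have hUi : MeasurableSet[info μ k] U := h.causal'.measurableSet_sample k
  have e : {ω | ((k + 1 : ℕ) : ℕ∞) ≤ τ ω} = A := by
    ext ω; simp [hA, ENat.add_one_le_iff]
  rw [valueAt, e, ← lintegral_inter_add_sdiff _ _ (hle _ hUi),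
    ← lintegral_inter_add_sdiff (fun ω => ENNReal.ofReal (M.nextValue p n μ k ω)) _ (hle _ hUi)]
  congr 1
  · have hAU : MeasurableSet[info μ k] (A ∩ U) := MeasurableSet.inter hAi hUi
    have hT : Measurable[info μ k] fun ω => (rights n μ k ω, M.post p μ k ω) :=
      (h.causal'.measurable_rights n k).prodMk (measurable_post_info h.causal' k)
    -- The state is known before slot `k + 1` and only `y` is integrated. The `clamp` changes
    -- nothing at posteriors but makes the integrand jointly measurable.
    have hG : Measurable (Function.uncurry fun (z : ℕ × ℝ) (y : ℝ) =>
        ENNReal.ofReal (M.V (z.1 - 1) (clamp (M.Φ₁ y z.2)))) := by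
      have h1 : Measurable fun w : (ℕ × ℝ) × ℝ => M.Φ₁ w.2 w.1.2 :=
        M.measurable_Φ₁.comp (measurable_snd.prodMk (measurable_snd.comp measurable_fst))
      have h2 : Measurable fun w : (ℕ × ℝ) × ℝ => w.1.1 - 1 :=
        (measurable_from_top (f := fun r : ℕ => r - 1)).comp (measurable_fst.comp measurable_fst)
      exact (M.measurable_V_clamp.comp (h2.prodMk h1)).ennreal_ofReal
    have hnext := lintegral_next (M := M) hp h.causal' hAU hT hG
    calc _ = ∫⁻ ω in A ∩ U, ENNReal.ofReal (M.V (rights n μ k ω - 1)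
          (clamp (M.Φ₁ (X (k + 1) ω) (M.post p μ k ω)))) ∂M.P p := by
          refine setLIntegral_congr_fun (hle _ hAU) fun ω hω => ?_
          have hω2 : μ (k + 1) ω = true := hω.2
          simp only [h.rights_of_sample hω2, post, if_pos hω2, add_tsub_cancel_right]
          rw [clamp_of_mem (M.Φ₁_mem (post_mem hp μ k ω) _)]
      _ = _ := hnext
      _ = _ := by
          refine setLIntegral_congr_fun (hle _ hAU) fun ω hω => ?_
          have hω2 : μ (k + 1) ω = true := hω.2
          have hq := post_mem (M := M) hp μ k ω
          simp only [nextValue, if_pos hω2]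
          rw [(M.isValue_V _).ofReal_sampleMean hq]
          simp_rw [clamp_of_mem (M.Φ₁_mem hq _)]
  · refine setLIntegral_congr_fun (MeasurableSet.diff (hle _ hAi) (hle _ hUi)) fun ω hω => ?_
    have hω2 : ¬ μ (k + 1) ω = true := hω.2
    simp only [nextValue, if_neg hω2, h.rights_of_not_sample hω2, post]

theorem nextValue_nonneg (hp : p ∈ Set.Icc (0 : ℝ) 1) (μ : ℕ → Sample → Bool) (k : ℕ)
    (ω : Sample) : 0 ≤ M.nextValue p n μ k ω := by
  have hq := post_mem (M := M) hp μ k ω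
  unfold nextValue; split_ifs
  · exact (M.isValue_V _).sampleMean_nonneg hq
  · exact (M.isValue_V _).nonneg _ (M.Φ₀_mem hq)

theorem measurable_stage (h : Admissible n μ τ) (k : ℕ) :
    Measurable fun ω => ENNReal.ofReal (M.c * M.post p μ k ω) :=
  ((measurable_post h.causal' k).const_mul _).ennreal_ofReal

theorem stageCost_add_valueAt_succ (hp : p ∈ Set.Icc (0 : ℝ) 1) (h : Admissible n μ τ) (k : ℕ) :
    M.stageCost p μ τ k + M.valueAt p n μ τ (k + 1) =
      ∫⁻ ω in {ω | (k : ℕ∞) < τ ω},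
        ENNReal.ofReal (M.c * M.post p μ k ω + M.nextValue p n μ k ω) ∂M.P p +
      ∫⁻ ω in {ω | τ ω = (k : ℕ∞)}, ENNReal.ofReal (1 - M.post p μ k ω) ∂M.P p := by
  rw [valueAt_succ hp h, stageCost, add_right_comm, ← lintegral_add_left (measurable_stage h k)]
  congr 2; ext ω
  rw [ENNReal.ofReal_add (mul_nonneg M.c_pos.le (post_mem hp μ k ω).1) (nextValue_nonneg hp μ k ω)]

theorem valueAt_eq (h : Admissible n μ τ) (k : ℕ) :
    M.valueAt p n μ τ k =
      ∫⁻ ω in {ω | (k : ℕ∞) < τ ω},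
        ENNReal.ofReal (M.V (rights n μ k ω) (M.post p μ k ω)) ∂M.P p +
      ∫⁻ ω in {ω | τ ω = (k : ℕ∞)},
        ENNReal.ofReal (M.V (rights n μ k ω) (M.post p μ k ω)) ∂M.P p := by
  have hle := h.causal'.info_le k
  rw [valueAt, ← lintegral_inter_add_sdiff _ _ (hle _ (h.measurableSet_lt k))]
  congr 3
  · ext ω
    simp only [Set.mem_inter_iff, Set.mem_ofPred_eq]
    exact ⟨fun h => h.2, fun h => ⟨h.le, h⟩⟩
  · ext ω
    simp only [Set.mem_sdiff, Set.mem_ofPred_eq, not_lt]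
    exact ⟨fun h => le_antisymm h.2 h.1, fun h => ⟨h.ge, h.le⟩⟩

/-- Cost so far plus current value is a submartingale under any admissible pair, by the one-slot
inequalities. -/
theorem valueAt_le_add (hp : p ∈ Set.Icc (0 : ℝ) 1) (h : Admissible n μ τ) (k : ℕ) :
    M.valueAt p n μ τ k ≤ M.stageCost p μ τ k + M.valueAt p n μ τ (k + 1) := by
  rw [stageCost_add_valueAt_succ hp h, valueAt_eq h]
  refine add_le_add (lintegral_mono fun ω => ENNReal.ofReal_le_ofReal ?_)
    (lintegral_mono fun ω => ENNReal.ofReal_le_ofReal ?_)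
  · have hq := post_mem (M := M) hp μ k ω
    unfold nextValue; split_ifs with hk
    · rw [h.rights_of_sample hk, add_tsub_cancel_right]
      exact V_le_sample hq _
    · exact V_le_wait hq _
  · exact (M.isValue_V _).le _ (post_mem hp μ k ω)

theorem valueAt_zero_le_sum (hp : p ∈ Set.Icc (0 : ℝ) 1) (h : Admissible n μ τ) (k : ℕ) :
    M.valueAt p n μ τ 0 ≤ ∑ j ∈ Finset.range k, M.stageCost p μ τ j + M.valueAt p n μ τ k := by
  induction k with
  | zero => simp
  | succ k ih =>
    refine ih.trans ?_
    rw [Finset.sum_range_succ, add_assoc]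
    exact add_le_add_right (valueAt_le_add hp h k) _

theorem valueAt_le_measure (hp : p ∈ Set.Icc (0 : ℝ) 1) (k : ℕ) :
    M.valueAt p n μ τ k ≤ M.P p {ω | (k : ℕ∞) ≤ τ ω} := by
  refine (lintegral_mono (g := fun _ => 1) fun ω => ?_).trans (by simp)
  exact ENNReal.ofReal_le_one.2 ((M.isValue_V _).mem (post_mem hp μ k ω)).2

/-- Since `Λ` is finite and `c > 0`, never stopping has infinite cost. -/
theorem ae_ne_top_of_risk_ne_top (h : Admissible n μ τ) (hr : M.risk p τ ≠ ⊤) :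
    ∀ᵐ ω ∂M.P p, τ ω ≠ ⊤ := by
  unfold risk at hr
  have hm : Measurable fun ω => (ENNReal.ofReal M.c * ((τ ω : ℝ≥0∞) - (Λ ω : ℝ≥0∞))
      + if τ ω < (Λ ω : ℕ∞) then 1 else 0) := by
    simp_rw [M.cost_eq_tsum]
    exact Measurable.tsum fun k => measurable_cost_term h k
  filter_upwards [ae_lt_top hm hr] with ω hω hτ
  rw [hτ, ENat.toENNReal_top, ENNReal.top_sub (ENNReal.natCast_ne_top _),
    ENNReal.mul_top (by simpa using M.c_pos)] at hω
  simp at hω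

/-- No admissible pair has a smaller cost than `V_n`. -/
theorem le_risk (hp : p ∈ Set.Icc (0 : ℝ) 1) (h : Admissible n μ τ) :
    ENNReal.ofReal (M.V n p) ≤ M.risk p τ := by
  have := M.isProbabilityMeasure_P hp
  by_cases hr : M.risk p τ = ⊤
  · rw [hr]; exact le_top
  have h0 := ae_ne_top_of_risk_ne_top h hr
  have hlim : Filter.Tendsto (fun k : ℕ => M.P p {ω | (k : ℕ∞) ≤ τ ω}) Filter.atTop
      (nhds (M.P p (⋂ k : ℕ, {ω | (k : ℕ∞) ≤ τ ω}))) := by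
    refine tendsto_measure_iInter_atTop (fun k => ?_) (fun j k hjk ω hω => ?_)
      ⟨0, measure_ne_top _ _⟩
    · exact (h.causal'.info_le k _ (h.measurableSet_ge k)).nullMeasurableSet
    · have hω' : (k : ℕ∞) ≤ τ ω := hω
      exact (Nat.cast_le.2 hjk).trans hω'
  have hz : M.P p (⋂ k : ℕ, {ω | (k : ℕ∞) ≤ τ ω}) = 0 := by
    refine measure_mono_null ?_ h0
    intro ω hω hτ
    apply hτ
    simp only [Set.mem_iInter, Set.mem_ofPred_eq] at hω
    exact ENat.eq_top_iff_forall_ge.2 hω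
  rw [hz] at hlim
  -- The values are at most `1`, so the remainder of the telescoped sum is at most the probability
  -- of still running.
  have hbound : ∀ k : ℕ, ENNReal.ofReal (M.V n p) ≤ M.risk p τ + M.P p {ω | (k : ℕ∞) ≤ τ ω} := by
    intro k
    rw [← valueAt_zero (μ := μ) (τ := τ) hp, risk_eq_tsum hp h]
    exact (valueAt_zero_le_sum hp h k).trans
      (add_le_add (ENNReal.sum_le_tsum _) (valueAt_le_measure hp k))
  have := ge_of_tendsto' (hlim.const_add (M.risk p τ)) hbound
  simpa using this

/-- A pair that attains the minimum in every step of the dynamic program is optimal. -/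
theorem risk_le_of_forall_eq (hp : p ∈ Set.Icc (0 : ℝ) 1) (h : Admissible n μ τ)
    (heq : ∀ᵐ ω ∂M.P p, ∀ k : ℕ,
      ((k : ℕ∞) < τ ω → M.V (rights n μ k ω) (M.post p μ k ω) =
        M.c * M.post p μ k ω + M.nextValue p n μ k ω) ∧
      (τ ω = (k : ℕ∞) → M.V (rights n μ k ω) (M.post p μ k ω) = 1 - M.post p μ k ω)) :
    M.risk p τ ≤ ENNReal.ofReal (M.V n p) := by
  have hstep : ∀ k, M.valueAt p n μ τ k = M.stageCost p μ τ k + M.valueAt p n μ τ (k + 1) := by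
    intro k
    have hle := h.causal'.info_le k
    rw [stageCost_add_valueAt_succ hp h, valueAt_eq h]
    congr 1
    · refine setLIntegral_congr_fun_ae (hle _ (h.measurableSet_lt k)) ?_
      filter_upwards [heq] with ω hω hk
      rw [(hω k).1 hk]
    · refine setLIntegral_congr_fun_ae (hle _ (h.measurableSet_eq k)) ?_
      filter_upwards [heq] with ω hω hk
      rw [(hω k).2 hk]
  have hsum : ∀ k, M.valueAt p n μ τ 0 =
      ∑ j ∈ Finset.range k, M.stageCost p μ τ j + M.valueAt p n μ τ k := by
    intro k
    induction k with
    | zero => simp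
    | succ k ih => rw [ih, hstep k, Finset.sum_range_succ, add_assoc]
  rw [risk_eq_tsum hp h, ← valueAt_zero (μ := μ) (τ := τ) hp]
  -- In this direction the remainder is simply dropped, so nothing about the finiteness of `τ` is
  -- needed.
  refine ENNReal.tsum_le_of_sum_range_le fun k => ?_
  rw [hsum k]
  exact le_self_add

end Model

end LimitedSampling

end

/-! ### Paths that follow the rule attain equality in every slot. -/

noncomputable section

namespace LimitedSampling

namespace Model

variable {M : Model} {p : ℝ} {N : ℕ} {μ : ℕ → Sample → Bool} {τ : Sample → ℕ∞}

/-- The rule at a single sample point `ω`, in terms of the recursively computed posterior. -/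
structure FollowsAt (M : Model) (p : ℝ) (N : ℕ) (μ : ℕ → Sample → Bool) (ω : Sample) (τ : ℕ∞)
    (t : ℕ → ℕ) (η : ℕ) : Prop where
  start : t 0 = 0
  interval : ∀ n < η, ∃ m ∈ M.waitArgmin (M.V (N - n - 1)) (M.post p μ (t n) ω),
    t (n + 1) = t n + m
  size : IsLeast {n | n ≤ N ∧ M.post p μ (t n) ω ∈ M.stopDomain N n} η
  sampling : ∀ k, 1 ≤ k → (μ k ω = true ↔ ∃ n, 1 ≤ n ∧ n ≤ η ∧ t n = k)
  stop_early : η < N → τ = (t η : ℕ∞)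
  stop_last : η = N → ∃ m ∈ M.blindArgmin (M.post p μ (t N) ω), τ = ((t N + m : ℕ) : ℕ∞)

namespace FollowsAt

variable {ω : Sample} {σ : ℕ∞} {t : ℕ → ℕ} {η : ℕ}

theorem lt (h : M.FollowsAt p N μ ω σ t η) {i j : ℕ} (hij : i < j) (hj : j ≤ η) : t i < t j := by
  induction j, hij using Nat.le_induction with
  | base =>
    obtain ⟨m, hm, e⟩ := h.interval i (by omega)
    have := hm.1
    rw [Nat.succ_eq_add_one]
    omega
  | succ j hij ih =>
    obtain ⟨m, hm, e⟩ := h.interval j (by omega)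
    have := hm.1
    have := ih (by omega)
    omega

theorem le (h : M.FollowsAt p N μ ω σ t η) {i j : ℕ} (hij : i ≤ j) (hj : j ≤ η) : t i ≤ t j := by
  rcases hij.eq_or_lt with rfl | h'
  · exact le_rfl
  · exact (h.lt h' hj).le

theorem lastSample_le (h : M.FollowsAt p N μ ω σ t η) : (t η : ℕ∞) ≤ σ := by
  rcases h.size.1.1.eq_or_lt with e | e
  · obtain ⟨m, -, hm⟩ := h.stop_last e
    rw [hm, e]
    exact_mod_cast Nat.le_add_right _ _
  · rw [h.stop_early e]

/-- The state at time `k`: after the `n`-th sample, with `n < η`, or `n = η` and no more samples. -/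
inductive State (M : Model) (p : ℝ) (N : ℕ) (μ : ℕ → Sample → Bool) (ω : Sample) (σ : ℕ∞)
    (t : ℕ → ℕ) (η : ℕ) (k : ℕ) : Prop
  | sampling (n j : ℕ) (hn : n < η) (hr : rights N μ k ω = N - n) (ht : t n ≤ k)
      (ht' : t (n + 1) = k + 1 + j)
      (hV : M.V (N - n) (M.post p μ k ω) = M.waitCost (M.V (N - n - 1)) (M.post p μ k ω) (j + 1))
  | stopped (hr : rights N μ k ω = N - η) (hσ : σ = (k : ℕ∞))
      (hV : M.V (N - η) (M.post p μ k ω) = 1 - M.post p μ k ω)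
  | blind (j : ℕ) (hr : rights N μ k ω = 0) (ht : t η ≤ k) (hσ : σ = ((k + j : ℕ) : ℕ∞))
      (hV : M.V 0 (M.post p μ k ω) = M.blindCost (M.post p μ k ω) j)

theorem state_sampleTime (hp : p ∈ Set.Icc (0 : ℝ) 1) (h : M.FollowsAt p N μ ω σ t η) {n k : ℕ}
    (hn : n ≤ η) (hk : t n = k) (hr : rights N μ k ω = N - n) : State M p N μ ω σ t η k := by
  subst hk
  have hq := post_mem (M := M) hp μ (t n) ω
  have hN := h.size.1.1
  rcases hn.eq_or_lt with rfl | hlt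
  · rcases hN.eq_or_lt with rfl | hlt
    · obtain ⟨m, hm, e⟩ := h.stop_last rfl
      exact .blind m (by simpa using hr) le_rfl e (V_zero_eq hq hm)
    · refine .stopped hr (h.stop_early hlt) ?_
      have h1 := h.size.1.2.2 hlt
      obtain ⟨r, hr⟩ : ∃ r, N - n = r + 1 := ⟨N - n - 1, by omega⟩
      rw [hr] at h1 ⊢
      exact min_eq_left h1
  · obtain ⟨m, hm, e⟩ := h.interval n hlt
    obtain ⟨j, rfl⟩ := Nat.exists_eq_add_of_le' hm.1
    refine .sampling n j hlt hr le_rfl (by omega) ?_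
    -- Minimality of `η` keeps the posterior out of the stopping domain, so the minimum in `G` is
    -- attained by waiting.
    have hnot : ¬ 1 - M.post p μ (t n) ω ≤
        ⨅ m : Set.Ici (1 : ℕ), M.waitCost (M.V (N - n - 1)) (M.post p μ (t n) ω) m := by
      intro hle
      have := h.size.2 ⟨hlt.le.trans hN, hq, fun _ => hle⟩
      omega
    rw [← (M.isValue_V _).iInf_waitCost_eq hq hm]
    obtain ⟨r, hr⟩ : ∃ r, N - n = r + 1 := ⟨N - n - 1, by omega⟩
    rw [hr] at hnot ⊢
    exact min_eq_right (not_le.1 hnot).le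

/-- The counter `j` is the number of blind slots left, before the next sample or before the final
stop. Each one keeps the rest of the plan optimal by `V_eq_wait` or `V_eq_blind`; a sample starts a
new plan. -/
theorem state_succ (hp : p ∈ Set.Icc (0 : ℝ) 1) (hadm : Admissible N μ τ)
    (h : M.FollowsAt p N μ ω σ t η) {k : ℕ} (hk : (k : ℕ∞) < σ) (hs : State M p N μ ω σ t η k) :
    M.V (rights N μ k ω) (M.post p μ k ω) = M.c * M.post p μ k ω + M.nextValue p N μ k ω ∧
      State M p N μ ω σ t η (k + 1) := by
  have hq := post_mem (M := M) hp μ k ω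
  have hN := h.size.1.1
  cases hs with
  | sampling n j hn hr ht ht' hV =>
    obtain ⟨r, hrn⟩ : ∃ r, N - n = r + 1 := ⟨N - n - 1, by omega⟩
    rw [hrn, add_tsub_cancel_right] at hV
    cases j with
    | zero =>
      have hμ : μ (k + 1) ω = true := (h.sampling (k + 1) (by omega)).2 ⟨n + 1, by omega, hn, ht'⟩
      refine ⟨?_, h.state_sampleTime hp hn ht' ?_⟩
      · rw [nextValue, if_pos hμ, hr, hrn, add_tsub_cancel_right, hV,
          (M.isValue_V r).waitCost_one hq]
      · have := hadm.rights_of_sample hμ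
        omega
    | succ j =>
      have hμ : ¬ μ (k + 1) ω = true := by
        rw [h.sampling (k + 1) (by omega)]
        rintro ⟨i, -, hi, e⟩
        rcases le_or_gt i n with hin | hin
        · have := h.le hin hn.le
          omega
        · have := h.le (Nat.succ_le_of_lt hin) hi
          rw [Nat.succ_eq_add_one] at this
          omega
      obtain ⟨e1, e2⟩ := V_eq_wait hq hV
      have hpost : M.post p μ (k + 1) ω = M.Φ₀ (M.post p μ k ω) := by rw [post, if_neg hμ]
      refine ⟨?_, .sampling n j hn ?_ (by omega) (by omega) ?_⟩
      · rw [nextValue, if_neg hμ, hr, hrn, e1]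
      · rw [hadm.rights_of_not_sample hμ, hr]
      · rw [hrn, add_tsub_cancel_right, hpost, e2]
  | stopped hr hσ hV => exact absurd hk (by rw [hσ]; exact lt_irrefl _)
  | blind j hr ht hσ hV =>
    cases j with
    | zero => exact absurd hk (by rw [hσ]; exact lt_irrefl _)
    | succ j =>
      have hμ : ¬ μ (k + 1) ω = true := by
        rw [h.sampling (k + 1) (by omega)]
        rintro ⟨i, -, hi, e⟩
        have := h.le hi le_rfl
        omega
      obtain ⟨e1, e2⟩ := V_eq_blind hq hV
      have hpost : M.post p μ (k + 1) ω = M.Φ₀ (M.post p μ k ω) := by rw [post, if_neg hμ]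
      refine ⟨?_, .blind j ?_ (by omega) ?_ ?_⟩
      · rw [nextValue, if_neg hμ, hr, e1]
      · rw [hadm.rights_of_not_sample hμ, hr]
      · rw [hσ]; congr 1; omega
      · rw [hpost, e2]

theorem state (hp : p ∈ Set.Icc (0 : ℝ) 1) (hadm : Admissible N μ τ)
    (h : M.FollowsAt p N μ ω σ t η) (k : ℕ) (hk : (k : ℕ∞) ≤ σ) : State M p N μ ω σ t η k := by
  induction k with
  | zero =>
    exact h.state_sampleTime hp (Nat.zero_le _) h.start (by rw [rights_zero, Nat.sub_zero])
  | succ k ih =>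
    have hk' : (k : ℕ∞) < σ := lt_of_lt_of_le (by exact_mod_cast k.lt_succ_self) hk
    exact (h.state_succ hp hadm hk' (ih hk'.le)).2

theorem value_eq (hp : p ∈ Set.Icc (0 : ℝ) 1) (hadm : Admissible N μ τ)
    (h : M.FollowsAt p N μ ω σ t η) (k : ℕ) :
    ((k : ℕ∞) < σ → M.V (rights N μ k ω) (M.post p μ k ω) =
        M.c * M.post p μ k ω + M.nextValue p N μ k ω) ∧
      (σ = (k : ℕ∞) → M.V (rights N μ k ω) (M.post p μ k ω) = 1 - M.post p μ k ω) := by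
  refine ⟨fun hk => (h.state_succ hp hadm hk (h.state hp hadm k hk.le)).1, fun hk => ?_⟩
  cases h.state hp hadm k hk.ge with
  -- This state is impossible at the stopping time: a later sampling time would still precede `σ`.
  | sampling n j hn hr ht ht' hV =>
    have h1 := h.lastSample_le
    rw [hk] at h1
    have h2 := h.le (Nat.succ_le_of_lt hn) le_rfl
    rw [Nat.succ_eq_add_one] at h2
    have h3 : t η ≤ k := by exact_mod_cast h1
    omega
  | stopped hr hσ hV => rw [hr, hV]
  | blind j hr ht hσ hV =>
    rw [hk] at hσ
    have : k = k + j := by exact_mod_cast hσ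
    obtain rfl : j = 0 := by omega
    rw [hr, hV, blindCost_zero]

end FollowsAt

/-- The two posteriors agree for all `k` off a single null set, so they may be compared at the
random times `t n ω`. -/
theorem FollowsRule.ae_followsAt (hp : p ∈ Set.Icc (0 : ℝ) 1) (hadm : Admissible N μ τ)
    {t : ℕ → Sample → ℕ} {η : Sample → ℕ} (h : M.FollowsRule p N μ τ t η) :
    ∀ᵐ ω ∂M.P p, M.FollowsAt p N μ ω (τ ω) (fun n => t n ω) (η ω) := by
  filter_upwards [ae_forall_posterior_eq hp hadm.causal', h.start, h.interval, h.size, h.sampling,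
    h.stop_early, h.stop_last] with ω h0 h1 h2 h3 h4 h5 h6
  simp only [h0] at h2 h3 h6
  exact ⟨h1, h2, h3, h4, h5, h6⟩

/-- Every admissible pair that follows the rule has the cost `V_N`. -/
theorem FollowsRule.risk_eq (hp : p ∈ Set.Icc (0 : ℝ) 1) (hadm : Admissible N μ τ)
    {t : ℕ → Sample → ℕ} {η : Sample → ℕ} (h : M.FollowsRule p N μ τ t η) :
    M.risk p τ = ENNReal.ofReal (M.V N p) := by
  refine le_antisymm (risk_le_of_forall_eq hp hadm ?_) (le_risk hp hadm)
  filter_upwards [h.ae_followsAt hp hadm] with ω hω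
  exact hω.value_eq hp hadm

end Model

end LimitedSampling

end

/-! ### Construction of an admissible pair that follows the rule. -/

noncomputable section

namespace LimitedSampling

namespace Model

variable (M : Model)

/-- The least minimizer of the cost of waiting and sampling. -/
def waitSel (V : ℝ → ℝ) (q : ℝ) : ℕ := sInf (M.waitArgmin V (clamp q))

/-- The least minimizer of the cost of stopping without observation. -/
def blindSel (q : ℝ) : ℕ := sInf (M.blindArgmin (clamp q))

variable {M}

theorem measurable_sInf_nat {s : ℝ → Set ℕ} (hne : ∀ q, (s q).Nonempty)
    (hs : ∀ m, MeasurableSet {q | m ∈ s q}) : Measurable fun q => sInf (s q) := by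
  classical
  have e : (fun q => sInf (s q)) = fun q => Nat.find (p := fun m => m ∈ s q) (hne q) := by
    ext q
    rw [Nat.sInf_def (hne q)]
  rw [e]
  exact measurable_find (p := fun q m => m ∈ s q) hne hs

theorem IsValue.waitSel_mem {V : ℝ → ℝ} (hV : IsValue V) {q : ℝ} (hq : q ∈ Set.Icc (0 : ℝ) 1) :
    M.waitSel V q ∈ M.waitArgmin V q := by
  rw [waitSel, clamp_of_mem hq]
  exact Nat.sInf_mem (hV.waitArgmin_nonempty hq)

theorem blindSel_mem {q : ℝ} (hq : q ∈ Set.Icc (0 : ℝ) 1) : M.blindSel q ∈ M.blindArgmin q := by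
  rw [blindSel, clamp_of_mem hq]
  exact Nat.sInf_mem (blindArgmin_nonempty hq)

theorem IsValue.measurable_waitSel {V : ℝ → ℝ} (hV : IsValue V) : Measurable (M.waitSel V) := by
  refine measurable_sInf_nat (fun q => hV.waitArgmin_nonempty (clamp_mem q)) fun m => ?_
  by_cases hm : 1 ≤ m
  · have : {q | m ∈ M.waitArgmin V (clamp q)} = ⋂ m' : Set.Ici (1 : ℕ),
        {q | M.waitCost V (clamp q) m ≤ M.waitCost V (clamp q) m'} := by
      ext q; simp [waitArgmin, hm]
    rw [this]
    exact MeasurableSet.iInter fun m' =>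
      measurableSet_le (hV.measurable_waitCost hm) (hV.measurable_waitCost m'.2)
  · have : {q | m ∈ M.waitArgmin V (clamp q)} = ∅ := by
      ext q; simp [waitArgmin, hm]
    rw [this]; exact MeasurableSet.empty

theorem measurable_blindSel : Measurable M.blindSel := by
  refine measurable_sInf_nat (fun q => blindArgmin_nonempty (clamp_mem q)) fun m => ?_
  have : {q | m ∈ M.blindArgmin (clamp q)} = ⋂ m' : ℕ,
      {q | M.blindCost (clamp q) m ≤ M.blindCost (clamp q) m'} := by
    ext q; simp [blindArgmin]
  rw [this]
  exact MeasurableSet.iInter fun m' =>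
    measurableSet_le ((measurable_blindCost m).comp measurable_clamp)
      ((measurable_blindCost m').comp measurable_clamp)

theorem measurableSet_stopDomain (N n : ℕ) : MeasurableSet (M.stopDomain N n) := by
  have : M.stopDomain N n = Set.Icc 0 1 ∩ {q | n < N → 1 - q ≤
      ⨅ m : Set.Ici (1 : ℕ), M.waitCost (M.V (N - n - 1)) (clamp q) m} := by
    ext q
    simp only [stopDomain, Set.mem_inter_iff, Set.mem_ofPred_eq]
    refine and_congr_right fun hq => ?_
    rw [clamp_of_mem hq]
  rw [this]
  refine measurableSet_Icc.inter ?_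
  by_cases hn : n < N
  · simp only [hn, forall_const]
    exact measurableSet_le (by fun_prop)
      (Measurable.iInf fun m : Set.Ici (1 : ℕ) => (M.isValue_V _).measurable_waitCost m.2)
  · simp [hn]

section Rule

variable (M) (p : ℝ) (N : ℕ)

/-- The sampling times of the rule, with the posteriors at these times. -/
def schedule : ℕ → Sample → ℕ × ℝ
  | 0, _ => (0, p)
  | n + 1, ω =>
    let s := schedule n ω
    let m := M.waitSel (M.V (N - n - 1)) s.2
    (s.1 + m, M.Φ₁ (X (s.1 + m) ω) (M.predict s.2 (m - 1)))

/-- The `n`-th sampling time of the rule. -/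
def ruleTime (n : ℕ) (ω : Sample) : ℕ := (M.schedule p N n ω).1

/-- The posterior at the `n`-th sampling time of the rule. -/
def rulePost (n : ℕ) (ω : Sample) : ℝ := (M.schedule p N n ω).2

/-- The sample size of the rule. -/
def ruleSize (ω : Sample) : ℕ := sInf {n | M.rulePost p N n ω ∈ M.stopDomain N n}

open Classical in
/-- The sampling strategy of the rule. -/
def ruleStrategy (k : ℕ) (ω : Sample) : Bool :=
  decide (∃ n, 1 ≤ n ∧ n ≤ M.ruleSize p N ω ∧ M.ruleTime p N n ω = k)

/-- The stopping time of the rule. -/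
def ruleStop (ω : Sample) : ℕ :=
  M.ruleTime p N (M.ruleSize p N ω) ω +
    if M.ruleSize p N ω = N then M.blindSel (M.rulePost p N N ω) else 0

variable {M p N}

theorem ruleTime_succ (n : ℕ) (ω : Sample) :
    M.ruleTime p N (n + 1) ω =
      M.ruleTime p N n ω + M.waitSel (M.V (N - n - 1)) (M.rulePost p N n ω) := rfl

theorem rulePost_succ (n : ℕ) (ω : Sample) :
    M.rulePost p N (n + 1) ω = M.Φ₁ (X (M.ruleTime p N (n + 1) ω) ω)
      (M.predict (M.rulePost p N n ω)
        (M.waitSel (M.V (N - n - 1)) (M.rulePost p N n ω) - 1)) := rfl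

theorem rulePost_mem (hp : p ∈ Set.Icc (0 : ℝ) 1) (n : ℕ) (ω : Sample) :
    M.rulePost p N n ω ∈ Set.Icc (0 : ℝ) 1 := by
  induction n with
  | zero => exact hp
  | succ n ih => rw [rulePost_succ]; exact M.Φ₁_mem (M.predict_mem ih _) _

theorem ruleWait_mem (hp : p ∈ Set.Icc (0 : ℝ) 1) (n : ℕ) (ω : Sample) :
    M.waitSel (M.V (N - n - 1)) (M.rulePost p N n ω) ∈
      M.waitArgmin (M.V (N - n - 1)) (M.rulePost p N n ω) :=
  (M.isValue_V _).waitSel_mem (rulePost_mem hp n ω)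

theorem ruleTime_strictMono (hp : p ∈ Set.Icc (0 : ℝ) 1) (ω : Sample) :
    StrictMono fun n => M.ruleTime p N n ω :=
  strictMono_nat_of_lt_succ fun n => by
    have := (ruleWait_mem (M := M) (N := N) hp n ω).1
    have := ruleTime_succ (M := M) (p := p) (N := N) n ω
    omega

theorem rulePost_mem_stopDomain (hp : p ∈ Set.Icc (0 : ℝ) 1) (ω : Sample) :
    M.rulePost p N N ω ∈ M.stopDomain N N :=
  ⟨rulePost_mem hp N ω, fun h => absurd h (lt_irrefl _)⟩

theorem ruleSize_isLeast (hp : p ∈ Set.Icc (0 : ℝ) 1) (ω : Sample) :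
    IsLeast {n | M.rulePost p N n ω ∈ M.stopDomain N n} (M.ruleSize p N ω) :=
  ⟨Nat.sInf_mem (s := {n | M.rulePost p N n ω ∈ M.stopDomain N n})
    ⟨N, rulePost_mem_stopDomain hp ω⟩, fun _ hn => Nat.sInf_le hn⟩

theorem ruleSize_le (hp : p ∈ Set.Icc (0 : ℝ) 1) (ω : Sample) : M.ruleSize p N ω ≤ N :=
  (ruleSize_isLeast hp ω).2 (rulePost_mem_stopDomain hp ω)

theorem succ_le_ruleSize_iff (hp : p ∈ Set.Icc (0 : ℝ) 1) (n : ℕ) (ω : Sample) :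
    n + 1 ≤ M.ruleSize p N ω ↔
      n ≤ M.ruleSize p N ω ∧ M.rulePost p N n ω ∉ M.stopDomain N n := by
  have h := ruleSize_isLeast (M := M) (N := N) hp ω
  constructor
  · intro hn
    refine ⟨by omega, fun hmem => ?_⟩
    have := h.2 hmem
    omega
  · rintro ⟨h1, h2⟩
    rcases h1.eq_or_lt with rfl | h1
    · exact absurd h.1 h2
    · exact h1

theorem ruleStrategy_iff (k : ℕ) (ω : Sample) : M.ruleStrategy p N k ω = true ↔
    ∃ n, 1 ≤ n ∧ n ≤ M.ruleSize p N ω ∧ M.ruleTime p N n ω = k := by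
  simp [ruleStrategy]

open Classical in
/-- The posterior of the rule after the `n`-th sample if this is taken at time `k`, and `-1`
otherwise. -/
def rulePostAt (M : Model) (p : ℝ) (N n k : ℕ) (ω : Sample) : ℝ :=
  if n ≤ M.ruleSize p N ω ∧ M.ruleTime p N n ω = k then M.rulePost p N n ω else -1

/-- The default `-1` is not a posterior, so one real-valued function records both whether sample `n`
falls at time `k` and the posterior there. -/
theorem rulePostAt_mem_iff (n k : ℕ) (ω : Sample) (B : Set ℝ) :
    M.rulePostAt p N n k ω ∈ Set.Ici 0 ∩ B ↔ (n ≤ M.ruleSize p N ω ∧ M.ruleTime p N n ω = k) ∧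
      0 ≤ M.rulePost p N n ω ∧ M.rulePost p N n ω ∈ B := by
  unfold rulePostAt
  split_ifs with h
  · simp [h]
  · simp only [Set.mem_inter_iff, Set.mem_Ici, h, false_and, iff_false]
    rintro ⟨h, -⟩
    norm_num at h

/-- The posteriors at time `j` from which the rule goes on to take sample `n + 1` at time `k`. -/
def goSet (M : Model) (N n j k : ℕ) : Set ℝ :=
  (M.stopDomain N n)ᶜ ∩ {q | j + M.waitSel (M.V (N - n - 1)) q = k}

theorem measurableSet_goSet (n j k : ℕ) : MeasurableSet (Set.Ici 0 ∩ M.goSet N n j k) := by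
  refine measurableSet_Ici.inter ((measurableSet_stopDomain N n).compl.inter ?_)
  exact ((measurable_from_top (f := fun m : ℕ => j + m)).comp
    (M.isValue_V _).measurable_waitSel) (measurableSet_singleton k)

/-- The decision to sample at `k` is made at the previous sampling time `j`, from the posterior held
then; `j < k` is what makes the rule causal. -/
theorem sampled_iff (hp : p ∈ Set.Icc (0 : ℝ) 1) (n k : ℕ) (ω : Sample) :
    (n + 1 ≤ M.ruleSize p N ω ∧ M.ruleTime p N (n + 1) ω = k) ↔
      ∃ j < k, M.rulePostAt p N n j ω ∈ Set.Ici 0 ∩ M.goSet N n j k := by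
  have h0 := (rulePost_mem (M := M) (N := N) hp n ω).1
  have hm := (ruleWait_mem (M := M) (N := N) hp n ω).1
  simp only [rulePostAt_mem_iff]
  simp only [succ_le_ruleSize_iff hp, ruleTime_succ, goSet, Set.mem_inter_iff,
    Set.mem_compl_iff, Set.mem_ofPred_eq]
  constructor
  · rintro ⟨⟨h1, h2⟩, h3⟩
    exact ⟨M.ruleTime p N n ω, by omega, ⟨h1, rfl⟩, h0, h2, h3⟩
  · rintro ⟨j, hj, ⟨h1, rfl⟩, -, h2, h3⟩
    exact ⟨⟨h1, h2⟩, h3⟩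

/-- At most one `j` contributes, namely the time of sample `n`; the `+ 1` in its term cancels the
default `-1`. -/
theorem rulePostAt_succ (hp : p ∈ Set.Icc (0 : ℝ) 1) (n k : ℕ) (ω : Sample) :
    M.rulePostAt p N (n + 1) k ω = -1 + ∑ j ∈ Finset.range k,
      (Set.Ici 0 ∩ M.goSet N n j k).indicator
        (fun q => M.Φ₁ (obsVal (M.ruleStrategy p N) k ω) (M.predict q (k - j - 1)) + 1)
        (M.rulePostAt p N n j ω) := by
  by_cases h : n + 1 ≤ M.ruleSize p N ω ∧ M.ruleTime p N (n + 1) ω = k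
  · obtain ⟨j, hj, hmem⟩ := (sampled_iff hp n k ω).1 h
    obtain ⟨⟨h1, h2⟩, -, h3⟩ := (rulePostAt_mem_iff n j ω _).1 hmem
    rw [Finset.sum_eq_single j, Set.indicator_of_mem hmem]
    · have e1 : M.rulePostAt p N n j ω = M.rulePost p N n ω := by
        rw [rulePostAt, if_pos ⟨h1, h2⟩]
      have e2 : M.waitSel (M.V (N - n - 1)) (M.rulePost p N n ω) = k - j := by
        have : j + M.waitSel (M.V (N - n - 1)) (M.rulePost p N n ω) = k := h3.2
        omega
      have e3 : obsVal (M.ruleStrategy p N) k ω = X k ω :=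
        obsVal_eq ((ruleStrategy_iff k ω).2 ⟨n + 1, by omega, h⟩)
      rw [rulePostAt, if_pos h, rulePost_succ, h.2, e1, e2, e3]
      ring
    · intro i _ hij
      refine Set.indicator_of_notMem (fun hi => hij ?_) _
      exact ((rulePostAt_mem_iff n i ω _).1 hi).1.2.symm.trans h2
    · intro hj'
      exact absurd (Finset.mem_range.2 hj) hj'
  · rw [rulePostAt, if_neg h, Finset.sum_eq_zero, add_zero]
    intro j hj
    refine Set.indicator_of_notMem (fun hi => h ?_) _
    exact (sampled_iff hp n k ω).2 ⟨j, Finset.mem_range.1 hj, hi⟩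

/-- There is no circularity: `obsVal` is measurable for the information of any strategy, causal or
not, and induction on `n` handles the earlier posteriors. -/
theorem measurable_rulePostAt (hp : p ∈ Set.Icc (0 : ℝ) 1) (n k : ℕ) :
    Measurable[info (M.ruleStrategy p N) k] (M.rulePostAt p N n k) := by
  induction n generalizing k with
  | zero =>
    have : M.rulePostAt p N 0 k = fun _ => if 0 = k then p else -1 := by
      ext ω; simp [rulePostAt, ruleTime, rulePost, schedule]
    rw [this]; exact measurable_const
  | succ n ih =>
    cases k with
    | zero =>
      have : M.rulePostAt p N (n + 1) 0 = fun _ => -1 := by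
        ext ω; rw [rulePostAt_succ hp]; simp
      rw [this]; exact measurable_const
    | succ k =>
      have e : M.rulePostAt p N (n + 1) (k + 1) = fun ω => -1 + ∑ j ∈ Finset.range (k + 1),
          (M.rulePostAt p N n j ⁻¹' (Set.Ici 0 ∩ M.goSet N n j (k + 1))).indicator
          (fun ω => M.Φ₁ (obsVal (M.ruleStrategy p N) (k + 1) ω)
            (M.predict (M.rulePostAt p N n j ω) (k + 1 - j - 1)) + 1) ω := by
        ext ω
        rw [rulePostAt_succ hp]
        rfl
      rw [e]
      refine Measurable.const_add (Finset.measurable_fun_sum _ fun j hj => ?_) _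
      have hj' : j ≤ k + 1 := (Finset.mem_range.1 hj).le
      have hm : Measurable[info (M.ruleStrategy p N) (k + 1)] (M.rulePostAt p N n j) :=
        (ih j).mono (info_mono _ hj') le_rfl
      have hpr : Measurable fun q => M.predict q (k + 1 - j - 1) := by
        simp_rw [predict_eq]; fun_prop
      refine Measurable.indicator ?_ (hm (measurableSet_goSet n j (k + 1)))
      exact (M.measurable_Φ₁.comp ((measurable_obsVal _ k).prodMk (hpr.comp hm))).add_const _

theorem causal_ruleStrategy (hp : p ∈ Set.Icc (0 : ℝ) 1) : Causal (M.ruleStrategy p N) := by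
  intro k
  refine measurable_to_bool ?_
  have : M.ruleStrategy p N (k + 1) ⁻¹' {true} = ⋃ n : ℕ, ⋃ j ∈ Finset.range (k + 1),
      M.rulePostAt p N n j ⁻¹' (Set.Ici 0 ∩ M.goSet N n j (k + 1)) := by
    ext ω
    simp only [Set.mem_preimage, Set.mem_singleton_iff, ruleStrategy_iff, Set.mem_iUnion,
      Finset.mem_range, exists_prop, ← sampled_iff hp]
    constructor
    · rintro ⟨n, h1, h2⟩
      obtain ⟨n, rfl⟩ := Nat.exists_eq_add_of_le' h1
      exact ⟨n, h2⟩
    · rintro ⟨n, h⟩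
      exact ⟨n + 1, by omega, h⟩
  rw [this]
  refine MeasurableSet.iUnion fun n => Finset.measurableSet_biUnion _ fun j hj => ?_
  exact info_mono _ (Nat.lt_succ_iff.1 (Finset.mem_range.1 hj)) _
    (measurable_rulePostAt hp n j (measurableSet_goSet n j (k + 1)))

theorem ruleStop_le_iff (hp : p ∈ Set.Icc (0 : ℝ) 1) (k : ℕ) (ω : Sample) :
    M.ruleStop p N ω ≤ k ↔ ∃ n, ∃ j < k + 1, M.rulePostAt p N n j ω ∈ Set.Ici 0 ∩
      (M.stopDomain N n ∩ {q | j + (if n = N then M.blindSel q else 0) ≤ k}) := by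
  have h := ruleSize_isLeast (M := M) (N := N) hp ω
  simp only [rulePostAt_mem_iff]
  simp only [Set.mem_inter_iff, Set.mem_ofPred_eq, ruleStop]
  constructor
  · intro hk
    refine ⟨M.ruleSize p N ω, M.ruleTime p N (M.ruleSize p N ω) ω, by omega, ⟨le_rfl, rfl⟩,
      (rulePost_mem hp _ ω).1, h.1, ?_⟩
    split_ifs at hk ⊢ with e
    · rw [e] at hk ⊢; exact hk
    · exact hk
  · rintro ⟨n, j, hj, ⟨h1, rfl⟩, -, h2, h3⟩
    obtain rfl : n = M.ruleSize p N ω := le_antisymm h1 (h.2 h2)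
    split_ifs at h3 ⊢ with e
    · rw [e] at h3 ⊢; exact h3
    · exact h3

theorem admissible_rule (hp : p ∈ Set.Icc (0 : ℝ) 1) :
    Admissible N (M.ruleStrategy p N) (fun ω => (M.ruleStop p N ω : ℕ∞)) where
  causal := causal_ruleStrategy hp
  rights_nonneg k ω := by
    rw [rightsLeft, sub_nonneg, Finset.sum_ite, Finset.sum_const_zero, add_zero, Finset.sum_const,
      nsmul_eq_mul, mul_one, Nat.cast_le]
    -- Every sampled slot is one of the first `ruleSize` sampling times, and `ruleSize` is at most
    -- `N`.
    calc _ ≤ ((Finset.Icc 1 (M.ruleSize p N ω)).image fun n => M.ruleTime p N n ω).card := by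
          refine Finset.card_le_card fun j hj => ?_
          obtain ⟨n, h1, h2, h3⟩ := (ruleStrategy_iff j ω).1 (Finset.mem_filter.1 hj).2
          exact Finset.mem_image.2 ⟨n, Finset.mem_Icc.2 ⟨h1, h2⟩, h3⟩
      _ ≤ _ := Finset.card_image_le
      _ ≤ N := by simpa using ruleSize_le hp ω
  stopping k := by
    have : {ω | (M.ruleStop p N ω : ℕ∞) ≤ (k : ℕ∞)} = ⋃ n : ℕ, ⋃ j ∈ Finset.range (k + 1),
        M.rulePostAt p N n j ⁻¹' (Set.Ici 0 ∩
          (M.stopDomain N n ∩ {q | j + (if n = N then M.blindSel q else 0) ≤ k})) := by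
      ext ω
      simp only [Set.mem_ofPred_eq, Nat.cast_le, ruleStop_le_iff hp, Set.mem_iUnion,
        Finset.mem_range, exists_prop, Set.mem_preimage]
    rw [this]
    refine MeasurableSet.iUnion fun n => Finset.measurableSet_biUnion _ fun j hj => ?_
    refine info_mono _ (Nat.lt_succ_iff.1 (Finset.mem_range.1 hj)) _
      (measurable_rulePostAt hp n j ?_)
    refine measurableSet_Ici.inter ((measurableSet_stopDomain N n).inter ?_)
    have hm : Measurable fun q => if n = N then M.blindSel q else 0 := by
      split_ifs
      · exact measurable_blindSel
      · exact measurable_const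
    exact ((measurable_from_top (f := fun m : ℕ => j + m)).comp hm) (measurableSet_Iic (a := k))

theorem post_add_of_not_sample {μ : ℕ → Sample → Bool} {ω : Sample} {s i : ℕ}
    (h : ∀ j, 1 ≤ j → j ≤ i → ¬ μ (s + j) ω = true) :
    M.post p μ (s + i) ω = M.predict (M.post p μ s ω) i := by
  induction i with
  | zero => rw [predict_zero, add_zero]
  | succ i ih =>
    have := h (i + 1) (by omega) le_rfl
    rw [← add_assoc] at this ⊢
    rw [post, if_neg this, ih fun j h1 h2 => h j h1 (by omega), predict_succ]

theorem post_ruleTime (hp : p ∈ Set.Icc (0 : ℝ) 1) {n : ℕ} {ω : Sample}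
    (hn : n ≤ M.ruleSize p N ω) :
    M.post p (M.ruleStrategy p N) (M.ruleTime p N n ω) ω = M.rulePost p N n ω := by
  induction n with
  | zero => rfl
  | succ n ih =>
    have hmono := ruleTime_strictMono (M := M) (N := N) hp ω
    have ht := ruleTime_succ (M := M) (p := p) (N := N) n ω
    obtain ⟨m, hm⟩ := Nat.exists_eq_add_of_le' (ruleWait_mem (M := M) (N := N) hp n ω).1
    have hμ : M.ruleStrategy p N (M.ruleTime p N (n + 1) ω) ω = true :=
      (ruleStrategy_iff _ ω).2 ⟨n + 1, by omega, hn, rfl⟩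
    have hμ' : ∀ j, 1 ≤ j → j ≤ m → ¬ M.ruleStrategy p N (M.ruleTime p N n ω + j) ω = true := by
      intro j h1 h2
      rw [ruleStrategy_iff]
      rintro ⟨i, -, -, hi⟩
      have l1 : n < i := hmono.lt_iff_lt.1 (by simp only [hi]; omega)
      have l2 : i < n + 1 := hmono.lt_iff_lt.1 (by simp only [hi]; omega)
      omega
    rw [hm, ← add_assoc] at ht
    rw [rulePost_succ, hm, add_tsub_cancel_right, ← ih (by omega), ← post_add_of_not_sample hμ']
    rw [ht] at hμ ⊢
    rw [post, if_pos hμ]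

theorem followsRule_rule (hp : p ∈ Set.Icc (0 : ℝ) 1) :
    M.FollowsRule p N (M.ruleStrategy p N) (fun ω => (M.ruleStop p N ω : ℕ∞))
      (M.ruleTime p N) (M.ruleSize p N) := by
  have hae : ∀ᵐ ω ∂M.P p, ∀ n ≤ M.ruleSize p N ω,
      M.posterior p (M.ruleStrategy p N) (M.ruleTime p N n ω) ω = M.rulePost p N n ω := by
    filter_upwards [ae_forall_posterior_eq (M := M) hp (causal_ruleStrategy (N := N) hp)]
      with ω hω n hn
    rw [hω, post_ruleTime hp hn]
  constructor
  · exact ae_of_all _ fun ω => rfl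
  · filter_upwards [hae] with ω hω n hn
    rw [hω n hn.le]
    exact ⟨_, ruleWait_mem hp n ω, ruleTime_succ n ω⟩
  · filter_upwards [hae] with ω hω
    have h := ruleSize_isLeast (M := M) (N := N) hp ω
    refine ⟨⟨ruleSize_le hp ω, ?_⟩, fun n hn => ?_⟩
    · rw [hω _ le_rfl]; exact h.1
    -- The posteriors are identified only up to `ruleSize`; minimality concerns only smaller `n`, so
    -- this suffices.
    · by_contra hlt
      have hle := (not_le.1 hlt).le
      have := hn.2
      rw [hω n hle] at this
      exact hlt (h.2 this)
  · exact ae_of_all _ fun ω k _ => ruleStrategy_iff k ω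
  · refine ae_of_all _ fun ω hlt => ?_
    rw [ruleStop, if_neg hlt.ne, add_zero]
  · filter_upwards [hae] with ω hω hN
    have := hω N hN.ge
    rw [this]
    refine ⟨M.blindSel (M.rulePost p N N ω), blindSel_mem (rulePost_mem hp N ω), ?_⟩
    rw [ruleStop, if_pos hN, hN]

end Rule

theorem J_eq {p : ℝ} (hp : p ∈ Set.Icc (0 : ℝ) 1) (n : ℕ) :
    M.J p n = ENNReal.ofReal (M.V n p) := by
  apply le_antisymm
  · rw [← (followsRule_rule (M := M) (N := n) hp).risk_eq hp (admissible_rule hp)]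
    exact iInf_le_of_le _ (iInf_le_of_le _ (iInf_le _ (admissible_rule hp)))
  · exact le_iInf fun μ => le_iInf fun τ => le_iInf fun h => le_risk hp h

end Model

end LimitedSampling

end

theorem theorem1 (M : LimitedSampling.Model) (N : ℕ) (p : ℝ) (hp₀ : 0 ≤ p) (hp₁ : p < 1) :
    -- the expectations and the minima in the recursion exist
    (∀ q ∈ Set.Icc (0 : ℝ) 1,
      (M.blindArgmin q).Nonempty ∧
      ∀ n : ℕ, (∀ m : ℕ, 1 ≤ m →
          MeasureTheory.Integrable (M.waitPayoff (M.V n) q m) (M.P q)) ∧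
        (M.waitArgmin (M.V n) q).Nonempty) ∧
    -- the optimal cost is finite and equals `V_n`
    (∀ n ≤ N, M.J p n ≠ ⊤ ∧ (M.J p n).toReal = M.V n p) ∧
    -- the rule given by the recursion can be followed by an admissible pair
    (∃ μ τ t η, LimitedSampling.Admissible N μ τ ∧ M.FollowsRule p N μ τ t η) ∧
    -- and every admissible pair that follows it is optimal
    (∀ μ τ t η, LimitedSampling.Admissible N μ τ → M.FollowsRule p N μ τ t η →
      M.risk p τ = M.J p N) := by
  have hp : p ∈ Set.Icc (0 : ℝ) 1 := ⟨hp₀, hp₁.le⟩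
  refine ⟨fun q hq => ⟨LimitedSampling.Model.blindArgmin_nonempty hq, fun n => ⟨fun m hm => ?_,
    (M.isValue_V n).waitArgmin_nonempty hq⟩⟩, fun n _ => ?_,
    ⟨_, _, _, _, LimitedSampling.Model.admissible_rule hp,
      LimitedSampling.Model.followsRule_rule hp⟩, fun μ τ t η hadm h => ?_⟩
  · obtain ⟨k, rfl⟩ := Nat.exists_eq_add_of_le' hm
    exact (M.isValue_V n).integrable_waitPayoff hq k
  · rw [LimitedSampling.Model.J_eq hp n]
    exact ⟨ENNReal.ofReal_ne_top, ENNReal.toReal_ofReal ((M.isValue_V n).nonneg p hp)⟩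
  · rw [LimitedSampling.Model.J_eq hp N, h.risk_eq hp hadm]
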